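/- Let $R=\mathbb{F}_2[D,D^{-1}]$ and let $0\le k_1,k_2\le n$. For $i=1,2$ let $H_i(D)$ be an $(n-k_i)\times n$ matrix over $\mathbb{F}_2[D]$ that is noncatastrophic (if $u(D)$ is a row vector of power series over $\mathbb{F}_2$ and all entries of $u(D)H_i(D)$ have finitely many nonzero coefficients, then so do all entries of $u(D)$) and delay-free ($H_i(0)$ has full row rank). Suppose that $$H_1(D)H_2^T(D^{-1})=A(D)\begin{bmatrix}\Gamma(D)&0\\0&0\end{bmatrix}B(D),$$ where $A(D)$ and $B(D)$ are invertible over $R$, of sizes $(n-k_1)\times(n-k_1)$ and $(n-k_2)\times(n-k_2)$, and $\Gamma(D)$ is a $c\times c$ diagonal matrix whose diagonal entries are (integer) powers of $D$. Finite-weight Pauli sequences modulo phase, on a stream of frames with $N$ qubits each, are written as vectors $(z(D)\,|\,x(D))\in R^N\times R^N$; multiplication by $D$ is the shift by one frame. A finite-depth circuit is a finite sequence of the following gates, each applied in every frame, acting on these vectors as follows: CNOT from qubit $i$ to qubit $j\ne i$ in the frame delayed by $k\in\mathbb{Z}$ ($x_j\mapsto x_j+D^kx_i$, $z_i\mapsto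 z_i+D^{-k}z_j$); Hadamard on qubit $i$ ($x_i\leftrightarrow z_i$); SWAP of two qubits; delay of qubit $i$ by $l\in\mathbb{Z}$ frames ($x_i\mapsto D^lx_i$, $z_i\mapsto D^lz_i$). Then $m:=k_1+k_2-n+c\ge 0$, $c+m\le n$, and there are finite-depth circuits $U$ (encoding) and $V$ (decoding), both acting only on the sender's $n$ qubits of each frame, with the following properties. Consider the stream that has in each frame $c$ qubits of the receiver and $n$ qubits of the sender, where the sender's first $c$ qubits are halves of ebits shared with the receiver (stabilized by $ZZ$ and $XX$), her last $m$ qubits are information qubits, and the other $n-m-c$ are ancillas (stabilized by $Z$). Let $S_0$ be the stabilizer ($R$-module) of this unencoded stream and $S=U(S_0)$. 1. Any two elements $(z_1|x_1),(z_2|x_2)$ of $S$ satisfy $z_1(D^{-1})\cdot x_2(D)+x_1(D^{-1})\cdot z_2(D)=0$, that is, $S$ is a commuting stabilizer; and the restriction of $S$ to the sender's qubits is the $R$-module generated by the rows of the quantum check matrix $$\left[\begin{array}{c|c}H_1(D)&0\\0&H_2(D)\end{array}\right].$$ Thus $U$ encodes an $[[n,k_1+k_2-n+c;c]]$ entanglement-assisted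 quantum convolutional code for this check matrix. 2. $V(S)=S_0$, and $V\circ U$ fixes the operators $Z_q$ and $X_q$ of each information qubit $q$, so $V$ recovers the information qubits. -/

import Mathlib

open Polynomial LaurentPolynomial

noncomputable section

namespace EAQCC

/-- Binary Laurent polynomials in the delay operator `D` (written `T 1` in Mathlib);
`T k` is `D ^ k` for `k : ℤ`. -/
abbrev BinLaurent : Type := LaurentPolynomial (ZMod 2)

/-! ### Classical check matrices -/

/-- A polynomial matrix, used as an encoder `u(D) ↦ u(D) H(D)` of the row code, is noncatastrophic:
no input sequence with infinitely many ones is sent to an output sequence with finitely many ones. -/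
def IsNoncatastrophic {r n : ℕ} (H : Matrix (Fin r) (Fin n) (ZMod 2)[X]) : Prop :=
  ∀ u : Fin r → PowerSeries (ZMod 2),
    (∀ j : Fin n,
      {t : ℕ | PowerSeries.coeff t (∑ i : Fin r, u i * (H i j : PowerSeries (ZMod 2))) ≠ 0}.Finite) →
    ∀ i : Fin r, {t : ℕ | PowerSeries.coeff t (u i) ≠ 0}.Finite

/-- A polynomial matrix is delay-free: the constant matrix `H(0)` has full row rank. -/
def IsDelayFree {r n : ℕ} (H : Matrix (Fin r) (Fin n) (ZMod 2)[X]) : Prop :=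
  LinearIndependent (ZMod 2) (fun (i : Fin r) (j : Fin n) => (H i j).coeff 0)

/-- The matrix `H₁(D) H₂ᵀ(D⁻¹)` over the binary Laurent polynomials. -/
def crossMatrix {r s n : ℕ} (H₁ : Matrix (Fin r) (Fin n) (ZMod 2)[X])
    (H₂ : Matrix (Fin s) (Fin n) (ZMod 2)[X]) : Matrix (Fin r) (Fin s) BinLaurent :=
  (H₁.map fun p => Polynomial.toLaurent p) *
    (H₂.map fun p => LaurentPolynomial.invert (Polynomial.toLaurent p)).transpose

/-- The `r × s` matrix with upper left `c × c` block `diag (D ^ γ 0, …, D ^ γ (c - 1))` and zeros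
elsewhere. -/
def monomialBlock (r s : ℕ) {c : ℕ} (γ : Fin c → ℤ) : Matrix (Fin r) (Fin s) BinLaurent :=
  Matrix.of fun i j => if h : i.val = j.val ∧ i.val < c then T (γ ⟨i.val, h.2⟩) else 0

/-- `M = A [Γ 0; 0 0] B` with `A`, `B` invertible over the Laurent polynomials and `Γ` a diagonal
`c × c` matrix whose diagonal entries are powers of `D`. -/
def HasMonomialSmithForm {r s : ℕ} (M : Matrix (Fin r) (Fin s) BinLaurent) (c : ℕ) : Prop :=
  c ≤ r ∧ c ≤ s ∧
    ∃ (A : Matrix (Fin r) (Fin r) BinLaurent) (B : Matrix (Fin s) (Fin s) BinLaurent)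
      (γ : Fin c → ℤ), IsUnit A ∧ IsUnit B ∧ M = A * monomialBlock r s γ * B

/-! ### Pauli sequences in the binary polynomial picture -/

/-- Finite-weight Pauli sequences, modulo phase, on a stream of frames whose qubits are labelled by
`ι`: the pair `(z(D) | x(D))`.  The coefficient of `D ^ t` in `z i` (in `x i`) tells whether the
Pauli matrix at qubit `i` of frame `t` contains a factor `Z` (a factor `X`).  Multiplication by
`D ^ l` is the shift by `l` frames, and addition is multiplication of Pauli sequences. -/
abbrev PauliSeq (ι : Type) : Type := (ι → BinLaurent) × (ι → BinLaurent)

/-- The operator `Z` on qubit `q` of frame `0`. -/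
def pauliZ {ι : Type} [DecidableEq ι] (q : ι) : PauliSeq ι := (Pi.single q 1, 0)

/-- The operator `X` on qubit `q` of frame `0`. -/
def pauliX {ι : Type} [DecidableEq ι] (q : ι) : PauliSeq ι := (0, Pi.single q 1)

/-- The shifted symplectic product `z₁(D⁻¹) · x₂(D) + x₁(D⁻¹) · z₂(D)`; it vanishes iff all shifts
of the two Pauli sequences commute. -/
def shiftedSymplectic {ι : Type} [Fintype ι] (P Q : PauliSeq ι) : BinLaurent :=
  ∑ i, (LaurentPolynomial.invert (P.1 i) * Q.2 i + LaurentPolynomial.invert (P.2 i) * Q.1 i)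

/-! ### Finite-depth shift-invariant Clifford circuits -/

/-- Shift-invariant gates; each of them is applied in every frame of the stream. -/
inductive Gate (ι : Type) : Type
  /-- CNOT from qubit `i` of each frame to qubit `j` of the frame delayed by `k`. -/
  | cnot (i j : ι) (hij : i ≠ j) (k : ℤ) : Gate ι
  /-- Hadamard on qubit `i` of each frame. -/
  | hadamard (i : ι) : Gate ι
  /-- Exchange of the qubits `i` and `j` of each frame. -/
  | swap (i j : ι) : Gate ι
  /-- Delay (advance, if `l < 0`) of qubit `i` by `l` frames. -/
  | delay (i : ι) (l : ℤ) : Gate ι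

/-- The effect of a gate on Pauli sequences by conjugation.  Every gate sends Laurent polynomials
to Laurent polynomials, that is, finite-weight sequences to finite-weight sequences. -/
def Gate.act {ι : Type} [DecidableEq ι] : Gate ι → PauliSeq ι →ₗ[BinLaurent] PauliSeq ι
  | .cnot i j _ k =>
    { toFun := fun P =>
        (Function.update P.1 i (P.1 i + T (-k) * P.1 j),
          Function.update P.2 j (P.2 j + T k * P.2 i))
      map_add' := by
        intro P Q
        ext q <;> simp only [Function.update_apply, Prod.fst_add, Prod.snd_add, Pi.add_apply] <;>
          split_ifs <;> simp only [mul_add] <;> abel_nf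
      map_smul' := by
        intro a P
        ext q <;> simp only [Function.update_apply, Prod.smul_fst, Prod.smul_snd, Pi.smul_apply,
          smul_eq_mul, RingHom.id_apply] <;> split_ifs <;> ring_nf }
  | .hadamard i =>
    { toFun := fun P => (Function.update P.1 i (P.2 i), Function.update P.2 i (P.1 i))
      map_add' := by
        intro P Q
        ext q <;> simp only [Function.update_apply, Prod.fst_add, Prod.snd_add, Pi.add_apply] <;>
          split_ifs <;> rfl
      map_smul' := by
        intro a P
        ext q <;> simp only [Function.update_apply, Prod.smul_fst, Prod.smul_snd, Pi.smul_apply,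
          smul_eq_mul, RingHom.id_apply] <;> split_ifs <;> rfl }
  | .swap i j =>
    { toFun := fun P => (P.1 ∘ Equiv.swap i j, P.2 ∘ Equiv.swap i j)
      map_add' := fun _ _ => rfl
      map_smul' := fun _ _ => rfl }
  | .delay i l =>
    { toFun := fun P =>
        (Function.update P.1 i (T l * P.1 i), Function.update P.2 i (T l * P.2 i))
      map_add' := by
        intro P Q
        ext q <;> simp only [Function.update_apply, Prod.fst_add, Prod.snd_add, Pi.add_apply] <;>
          split_ifs <;> simp only [mul_add]
      map_smul' := by
        intro a P
        ext q <;> simp only [Function.update_apply, Prod.smul_fst, Prod.smul_snd, Pi.smul_apply,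
          smul_eq_mul, RingHom.id_apply] <;> split_ifs <;> ring_nf }

/-- A finite-depth circuit: a finite list of shift-invariant gates, the head being applied first. -/
abbrev Circuit (ι : Type) : Type := List (Gate ι)

/-- The effect of a circuit on Pauli sequences. -/
def Circuit.act {ι : Type} [DecidableEq ι] : Circuit ι → PauliSeq ι →ₗ[BinLaurent] PauliSeq ι
  | [] => LinearMap.id
  | g :: gs => (Circuit.act gs).comp g.act

/-- Relabelling the qubits that a gate acts on. -/
def Gate.relabel {ι κ : Type} (f : ι ↪ κ) : Gate ι → Gate κ
  | .cnot i j hij k => .cnot (f i) (f j) (f.injective.ne hij) k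
  | .hadamard i => .hadamard (f i)
  | .swap i j => .swap (f i) (f j)
  | .delay i l => .delay (f i) l

/-- In every frame the receiver holds `c` qubits (his halves of the ebits, on the left) and there
are `n` qubits that the sender transmits (on the right).  This is the effect, on the whole stream,
of a circuit on the `n` transmitted qubits; the receiver's halves are not touched. -/
def senderAct (c : ℕ) {n : ℕ} (C : Circuit (Fin n)) :
    PauliSeq (Fin c ⊕ Fin n) →ₗ[BinLaurent] PauliSeq (Fin c ⊕ Fin n) :=
  Circuit.act (C.map (Gate.relabel Function.Embedding.inr))

/-- The part of a Pauli sequence that acts on the sender's `n` qubits. -/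
def senderPart (c n : ℕ) : PauliSeq (Fin c ⊕ Fin n) →ₗ[BinLaurent] PauliSeq (Fin n) :=
  (LinearMap.funLeft BinLaurent BinLaurent Sum.inr).prodMap
    (LinearMap.funLeft BinLaurent BinLaurent Sum.inr)

/-! ### Entanglement-assisted quantum convolutional codes -/

/-- The stabilizer of the unencoded stream.  In each frame the first `c` of the sender's `n` qubits
are halves of ebits shared with the receiver (stabilized by `ZZ` and `XX`), the last `m` are
information qubits, and those in between are ancillas (stabilized by `Z`). -/
def unencodedStabilizer (n c m : ℕ) : Submodule BinLaurent (PauliSeq (Fin c ⊕ Fin n)) :=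
  Submodule.span BinLaurent
    ({P | ∃ (i : Fin c) (q : Fin n), q.val = i.val ∧
        (P = pauliZ (Sum.inl i) + pauliZ (Sum.inr q) ∨
          P = pauliX (Sum.inl i) + pauliX (Sum.inr q))} ∪
      {P | ∃ q : Fin n, c ≤ q.val ∧ q.val + m < n ∧ P = pauliZ (Sum.inr q)})

/-- The stabilizer of the stream after the sender has applied the circuit `enc`. -/
def encodedStabilizer {n : ℕ} (c m : ℕ) (enc : Circuit (Fin n)) :
    Submodule BinLaurent (PauliSeq (Fin c ⊕ Fin n)) :=
  (unencodedStabilizer n c m).map (senderAct c enc)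

/-- The module generated by the rows of the quantum check matrix
`[H₁(D) | 0; 0 | H₂(D)]` in CSS form, `Z` part on the left. -/
def cssCheckModule {r s n : ℕ} (H₁ : Matrix (Fin r) (Fin n) (ZMod 2)[X])
    (H₂ : Matrix (Fin s) (Fin n) (ZMod 2)[X]) : Submodule BinLaurent (PauliSeq (Fin n)) :=
  Submodule.span BinLaurent
    ((Set.range fun i : Fin r => ((fun j => Polynomial.toLaurent (H₁ i j), 0) : PauliSeq (Fin n))) ∪
      Set.range fun i : Fin s => ((0, fun j => Polynomial.toLaurent (H₂ i j)) : PauliSeq (Fin n)))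

/-- `enc` encodes `m` information qubits per frame, with `c` ebits and `n - m - c` ancillas per
frame, into an `[[n, m; c]]` entanglement-assisted quantum convolutional code for the quantum check
matrix of `H₁`, `H₂`: the encoded stabilizer commutes, and its restriction to the sender's qubits
is, up to row operations, the quantum check matrix. -/
def IsEncodingCircuit {r s n : ℕ} (H₁ : Matrix (Fin r) (Fin n) (ZMod 2)[X])
    (H₂ : Matrix (Fin s) (Fin n) (ZMod 2)[X]) (c m : ℕ) (enc : Circuit (Fin n)) : Prop :=
  c + m ≤ n ∧
  (∀ P ∈ encodedStabilizer c m enc, ∀ Q ∈ encodedStabilizer c m enc,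
    shiftedSymplectic P Q = 0) ∧
  (encodedStabilizer c m enc).map (senderPart c n) = cssCheckModule H₁ H₂

/-- `dec` decodes what `enc` has encoded: the encoded stabilizer is taken back to the stabilizer of
the unencoded stream, and the encoded logical operators of the information qubits (the last `m`
qubits of each frame) to the `Z` and `X` operators of these same qubits. -/
def IsDecodingCircuit {n : ℕ} (c m : ℕ) (enc dec : Circuit (Fin n)) : Prop :=
  (encodedStabilizer c m enc).map (senderAct c dec) = unencodedStabilizer n c m ∧
  ∀ q : Fin n, n ≤ q.val + m →
    senderAct c dec (senderAct c enc (pauliZ (Sum.inr q))) = pauliZ (Sum.inr q) ∧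
    senderAct c dec (senderAct c enc (pauliX (Sum.inr q))) = pauliX (Sum.inr q)

end EAQCC

end

/-!
The encoder is found backwards: a circuit `C` is constructed that brings the check matrix to a
normal form, `dec` is `C` and `enc` is its inverse (every gate has an inverse gate).

Over the Laurent polynomials `R`, the rows of a noncatastrophic matrix form a primitive family
(`IsPrimitiveFamily`): a linear combination is divisible by `d ≠ 0` only if its coefficients are.
Indeed, if a polynomial `p` with `p(0) ≠ 0` divides `v H`, then the power series `v / p` is sent
to a polynomial vector by `H`, so it is polynomial
(`IsNoncatastrophic.isPrimitiveFamily`).  Primitivity is invariant under invertible row operations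
and under circuits.

The Smith form of `H₁(D) H₂ᵀ(D⁻¹)` says that row operations on `H₁` and on `H₂`, which do not change
the module generated by the rows of the check matrix, give families `a` of type `Z` and `b` of type
`X` with shifted symplectic products `⟨a i, b j⟩ = 1` for `i = j < c` and `0` otherwise
(`HasMonomialSmithForm.exists_isUnit`, `shiftedSymplectic_rowCombination`).

CNOTs carry out the Euclidean algorithm on the entries of a `Z` type vector
(`exists_circuit_euclid`), so that a primitive family of `r` vectors is taken to `Z` on the first
`r` qubits (`IsPrimitiveFamily.exists_circuit_pauliZ`); primitivity enters by making the pivots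
units, that is, powers of `D`, which delays remove.  Apply this to `a`.  As circuits preserve the
symplectic product, the first `r` coordinates of `b j` are then those of the `j`-th standard vector
for `j < c`, and zero for `j ≥ c`.  CNOTs controlled by the first `c` qubits clear the other
coordinates of `b j`, `j < c`, which becomes `X` on qubit `j`.  The remaining `b j` live on the
qubits from `r` on; Hadamard gates there make them of type `Z`, and the reduction of primitive
families applies once more (`exists_circuit_normalForm`).  It also shows that `r + (s - c) ≤ n` for
`r = n - k₁`, `s = n - k₂`, that is, `m ≥ 0`.

In the normal form the check matrix is the sender's part of the unencoded stabilizer, ebits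
contributing `Z` and `X` and ancillas contributing `Z`
(`map_senderPart_unencodedStabilizer`), and the encoded stabilizer commutes because the unencoded
one does.
-/

noncomputable section

namespace EAQCC

/-! ### Gates and circuits -/

section Circuits

variable {ι κ : Type}

/-- Laurent polynomials over `ZMod 2` have characteristic two. -/
theorem binLaurent_add_self (a : BinLaurent) : a + a = 0 := by
  ext t
  exact CharTwo.add_self_eq_zero (a.coeff t)

theorem Gate.act_cnot_fst [DecidableEq ι] (i j : ι) (hij : i ≠ j) (k : ℤ) (P : PauliSeq ι) :
    ((Gate.cnot i j hij k).act P).1 = Function.update P.1 i (P.1 i + T (-k) * P.1 j) := rfl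

theorem Gate.act_cnot_snd [DecidableEq ι] (i j : ι) (hij : i ≠ j) (k : ℤ) (P : PauliSeq ι) :
    ((Gate.cnot i j hij k).act P).2 = Function.update P.2 j (P.2 j + T k * P.2 i) := rfl

theorem Gate.act_hadamard_fst [DecidableEq ι] (i : ι) (P : PauliSeq ι) :
    ((Gate.hadamard i).act P).1 = Function.update P.1 i (P.2 i) := rfl

theorem Gate.act_hadamard_snd [DecidableEq ι] (i : ι) (P : PauliSeq ι) :
    ((Gate.hadamard i).act P).2 = Function.update P.2 i (P.1 i) := rfl

theorem Gate.act_swap_fst [DecidableEq ι] (i j : ι) (P : PauliSeq ι) :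
    ((Gate.swap i j).act P).1 = P.1 ∘ Equiv.swap i j := rfl

theorem Gate.act_swap_snd [DecidableEq ι] (i j : ι) (P : PauliSeq ι) :
    ((Gate.swap i j).act P).2 = P.2 ∘ Equiv.swap i j := rfl

theorem Gate.act_delay_fst [DecidableEq ι] (i : ι) (l : ℤ) (P : PauliSeq ι) :
    ((Gate.delay i l).act P).1 = Function.update P.1 i (T l * P.1 i) := rfl

theorem Gate.act_delay_snd [DecidableEq ι] (i : ι) (l : ℤ) (P : PauliSeq ι) :
    ((Gate.delay i l).act P).2 = Function.update P.2 i (T l * P.2 i) := rfl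

theorem Circuit.act_nil [DecidableEq ι] (P : PauliSeq ι) :
    Circuit.act ([] : Circuit ι) P = P := rfl

theorem Circuit.act_cons [DecidableEq ι] (g : Gate ι) (C : Circuit ι) (P : PauliSeq ι) :
    Circuit.act (g :: C) P = Circuit.act C (g.act P) := rfl

theorem Circuit.act_append [DecidableEq ι] (C C' : Circuit ι) (P : PauliSeq ι) :
    Circuit.act (C ++ C') P = Circuit.act C' (Circuit.act C P) := by
  induction C generalizing P with
  | nil => rfl
  | cons g C ih => exact ih _

/-- The inverse gate: all gates but the delays are involutions. -/
def Gate.inv : Gate ι → Gate ι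
  | .delay i l => .delay i (-l)
  | g => g

theorem Gate.inv_inv (g : Gate ι) : g.inv.inv = g := by
  cases g <;> simp [Gate.inv]

theorem Gate.act_inv_act [DecidableEq ι] (g : Gate ι) (P : PauliSeq ι) :
    g.inv.act (g.act P) = P := by
  have hT : ∀ (k : ℤ) (a : BinLaurent), T (-k) * (T k * a) = a := fun k a => by
    rw [← mul_assoc, ← T_add]; simp
  cases g with
  | cnot i j hij k =>
    refine Prod.ext ?_ ?_ <;>
      simp only [Gate.inv, Gate.act_cnot_fst, Gate.act_cnot_snd, Function.update_self,
        Function.update_of_ne hij, Function.update_of_ne hij.symm, add_assoc, binLaurent_add_self,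
        add_zero, Function.update_idem, Function.update_eq_self]
  | hadamard i =>
    refine Prod.ext ?_ ?_ <;>
      simp only [Gate.inv, Gate.act_hadamard_fst, Gate.act_hadamard_snd, Function.update_self,
        Function.update_idem, Function.update_eq_self]
  | swap i j =>
    refine Prod.ext ?_ ?_ <;> funext q <;>
      simp [Gate.inv, Gate.act_swap_fst, Gate.act_swap_snd]
  | delay i l =>
    refine Prod.ext ?_ ?_ <;>
      simp only [Gate.inv, Gate.act_delay_fst, Gate.act_delay_snd, Function.update_self,
        Function.update_idem, hT, Function.update_eq_self]

/-- The inverse circuit. -/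
def Circuit.inv (C : Circuit ι) : Circuit ι := (C.map Gate.inv).reverse

theorem Circuit.act_inv_act [DecidableEq ι] (C : Circuit ι) (P : PauliSeq ι) :
    Circuit.act (Circuit.inv C) (Circuit.act C P) = P := by
  induction C generalizing P with
  | nil => rfl
  | cons g C ih =>
    have : Circuit.inv (g :: C) = Circuit.inv C ++ [g.inv] := by simp [Circuit.inv]
    rw [this, Circuit.act_append, Circuit.act_cons g C, ih, Circuit.act_cons, Circuit.act_nil,
      Gate.act_inv_act]

theorem Circuit.inv_inv (C : Circuit ι) : Circuit.inv (Circuit.inv C) = C := by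
  simp [Circuit.inv, Function.comp_def, Gate.inv_inv]

theorem Circuit.act_act_inv [DecidableEq ι] (C : Circuit ι) (P : PauliSeq ι) :
    Circuit.act C (Circuit.act (Circuit.inv C) P) = P := by
  simpa only [Circuit.inv_inv] using Circuit.act_inv_act (Circuit.inv C) P

theorem Gate.inv_relabel (f : ι ↪ κ) (g : Gate ι) : (g.relabel f).inv = g.inv.relabel f := by
  cases g <;> rfl

/-- Relabelling the qubits of a circuit along an embedding. -/
abbrev Circuit.relabel (f : ι ↪ κ) (C : Circuit ι) : Circuit κ := C.map (Gate.relabel f)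

theorem Circuit.inv_relabel (f : ι ↪ κ) (C : Circuit ι) :
    Circuit.inv (Circuit.relabel f C) = Circuit.relabel f (Circuit.inv C) := by
  simp [Circuit.inv, Circuit.relabel, Function.comp_def, Gate.inv_relabel]

/-- The part of a Pauli sequence on the qubits in the range of `f`. -/
def PauliSeq.restrict (f : ι ↪ κ) (P : PauliSeq κ) : PauliSeq ι := (P.1 ∘ f, P.2 ∘ f)

theorem Gate.restrict_act_relabel [DecidableEq ι] [DecidableEq κ]
    (f : ι ↪ κ) (g : Gate ι) (P : PauliSeq κ) :
    ((g.relabel f).act P).restrict f = g.act (P.restrict f) := by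
  cases g with
  | cnot i j hij k =>
    refine Prod.ext ?_ ?_ <;> funext q <;>
      simp [PauliSeq.restrict, Gate.relabel, Gate.act_cnot_fst, Gate.act_cnot_snd,
        Function.update_apply]
  | hadamard i =>
    refine Prod.ext ?_ ?_ <;> funext q <;>
      simp [PauliSeq.restrict, Gate.relabel, Gate.act_hadamard_fst, Gate.act_hadamard_snd,
        Function.update_apply]
  | swap i j =>
    refine Prod.ext ?_ ?_ <;> funext q <;>
      simp [PauliSeq.restrict, Gate.relabel, Gate.act_swap_fst, Gate.act_swap_snd,
        Function.Embedding.swap_apply]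
  | delay i l =>
    refine Prod.ext ?_ ?_ <;> funext q <;>
      simp [PauliSeq.restrict, Gate.relabel, Gate.act_delay_fst, Gate.act_delay_snd,
        Function.update_apply]

theorem Circuit.restrict_act_relabel [DecidableEq ι] [DecidableEq κ]
    (f : ι ↪ κ) (C : Circuit ι) (P : PauliSeq κ) :
    (Circuit.act (Circuit.relabel f C) P).restrict f = Circuit.act C (P.restrict f) := by
  induction C generalizing P with
  | nil => rfl
  | cons g C ih =>
    rw [Circuit.relabel, List.map_cons, Circuit.act_cons, ih, Gate.restrict_act_relabel,
      Circuit.act_cons]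

theorem Gate.act_relabel_of_notMem_range [DecidableEq κ]
    (f : ι ↪ κ) (g : Gate ι) (P : PauliSeq κ) {q : κ}
    (hq : q ∉ Set.range f) :
    ((g.relabel f).act P).1 q = P.1 q ∧ ((g.relabel f).act P).2 q = P.2 q := by
  have hne : ∀ i, q ≠ f i := fun i h => hq ⟨i, h.symm⟩
  cases g with
  | cnot i j hij k =>
    simp [Gate.relabel, Gate.act_cnot_fst, Gate.act_cnot_snd, Function.update_of_ne (hne _)]
  | hadamard i =>
    simp [Gate.relabel, Gate.act_hadamard_fst, Gate.act_hadamard_snd,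
      Function.update_of_ne (hne _)]
  | swap i j =>
    simp [Gate.relabel, Gate.act_swap_fst, Gate.act_swap_snd,
      Equiv.swap_apply_of_ne_of_ne (hne i) (hne j)]
  | delay i l =>
    simp [Gate.relabel, Gate.act_delay_fst, Gate.act_delay_snd, Function.update_of_ne (hne _)]

theorem Circuit.act_relabel_of_notMem_range [DecidableEq κ]
    (f : ι ↪ κ) (C : Circuit ι) (P : PauliSeq κ) {q : κ}
    (hq : q ∉ Set.range f) :
    (Circuit.act (Circuit.relabel f C) P).1 q = P.1 q ∧
      (Circuit.act (Circuit.relabel f C) P).2 q = P.2 q := by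
  induction C generalizing P with
  | nil => exact ⟨rfl, rfl⟩
  | cons g C ih =>
    have h := Gate.act_relabel_of_notMem_range f g P hq
    rw [Circuit.relabel, List.map_cons, Circuit.act_cons]
    exact ⟨(ih _).1.trans h.1, (ih _).2.trans h.2⟩

/-- The image of a Pauli sequence under a relabelled circuit is determined by its restriction to
the relabelled qubits and its values elsewhere. -/
theorem Circuit.act_relabel_eq [DecidableEq ι] [DecidableEq κ]
    (f : ι ↪ κ) (C : Circuit ι) {P Q : PauliSeq κ}
    (h : Circuit.act C (P.restrict f) = Q.restrict f)
    (h' : ∀ q ∉ Set.range f, P.1 q = Q.1 q ∧ P.2 q = Q.2 q) :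
    Circuit.act (Circuit.relabel f C) P = Q := by
  rw [← Circuit.restrict_act_relabel] at h
  refine Prod.ext ?_ ?_ <;> funext q <;> by_cases hq : q ∈ Set.range f
  · obtain ⟨i, rfl⟩ := hq
    exact congrFun (congrArg Prod.fst h) i
  · rw [(Circuit.act_relabel_of_notMem_range f C P hq).1, (h' q hq).1]
  · obtain ⟨i, rfl⟩ := hq
    exact congrFun (congrArg Prod.snd h) i
  · rw [(Circuit.act_relabel_of_notMem_range f C P hq).2, (h' q hq).2]

/-- A circuit on the qubits in the range of `f` fixes the Pauli sequences supported elsewhere. -/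
theorem Circuit.act_relabel_of_restrict_eq_zero [DecidableEq ι] [DecidableEq κ]
    (f : ι ↪ κ) (C : Circuit ι) {P : PauliSeq κ}
    (h : P.restrict f = 0) : Circuit.act (Circuit.relabel f C) P = P :=
  Circuit.act_relabel_eq f C (by rw [h, map_zero]) fun _ _ => ⟨rfl, rfl⟩

/-! ### Circuits without Hadamard gates -/

/-- Circuits made of CNOTs, SWAPs and delays; they do not mix the `Z` and the `X` part. -/
def Circuit.HadamardFree (C : Circuit ι) : Prop := ∀ g ∈ C, ∀ i, g ≠ Gate.hadamard i

theorem Circuit.HadamardFree.nil : Circuit.HadamardFree ([] : Circuit ι) := by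
  simp [Circuit.HadamardFree]

theorem Circuit.HadamardFree.append {C C' : Circuit ι} (h : Circuit.HadamardFree C)
    (h' : Circuit.HadamardFree C') : Circuit.HadamardFree (C ++ C') := fun g hg =>
  (List.mem_append.1 hg).elim (h g) (h' g)

theorem Circuit.HadamardFree.cons {g : Gate ι} {C : Circuit ι} (hg : ∀ i, g ≠ Gate.hadamard i)
    (h : Circuit.HadamardFree C) : Circuit.HadamardFree (g :: C) := fun g' hg' => by
  rcases List.mem_cons.1 hg' with rfl | h'
  exacts [hg, h g' h']

theorem Circuit.HadamardFree.relabel {C : Circuit ι} (h : Circuit.HadamardFree C) (f : ι ↪ κ) :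
    Circuit.HadamardFree (Circuit.relabel f C) := by
  intro g hg i
  obtain ⟨g', hg', rfl⟩ := List.mem_map.1 hg
  cases g' with
  | hadamard j => exact absurd rfl (h _ hg' j)
  | _ => simp [Gate.relabel]

theorem Circuit.HadamardFree.act_snd_eq_zero [DecidableEq ι] {C : Circuit ι} (h : Circuit.HadamardFree C)
    {P : PauliSeq ι} (hP : P.2 = 0) : (Circuit.act C P).2 = 0 := by
  induction C generalizing P with
  | nil => exact hP
  | cons g C ih =>
    refine ih (fun g' hg' => h g' (List.mem_cons_of_mem _ hg')) ?_
    cases g with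
    | cnot i j hij k => rw [Gate.act_cnot_snd, hP]; simp
    | hadamard i => exact absurd rfl (h _ List.mem_cons_self i)
    | swap i j => rw [Gate.act_swap_snd, hP]; rfl
    | delay i l => rw [Gate.act_delay_snd, hP]; simp

theorem Circuit.HadamardFree.act_fst_eq_zero [DecidableEq ι] {C : Circuit ι} (h : Circuit.HadamardFree C)
    {P : PauliSeq ι} (hP : P.1 = 0) : (Circuit.act C P).1 = 0 := by
  induction C generalizing P with
  | nil => exact hP
  | cons g C ih =>
    refine ih (fun g' hg' => h g' (List.mem_cons_of_mem _ hg')) ?_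
    cases g with
    | cnot i j hij k => rw [Gate.act_cnot_fst, hP]; simp
    | hadamard i => exact absurd rfl (h _ List.mem_cons_self i)
    | swap i j => rw [Gate.act_swap_fst, hP]; rfl
    | delay i l => rw [Gate.act_delay_fst, hP]; simp

/-! ### The shifted symplectic product -/

variable [Fintype ι]

theorem shiftedSymplectic_add_left (P P' Q : PauliSeq ι) :
    shiftedSymplectic (P + P') Q = shiftedSymplectic P Q + shiftedSymplectic P' Q := by
  simp only [shiftedSymplectic, Prod.fst_add, Prod.snd_add, Pi.add_apply, map_add, add_mul,
    Finset.sum_add_distrib]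
  abel

theorem shiftedSymplectic_add_right (P Q Q' : PauliSeq ι) :
    shiftedSymplectic P (Q + Q') = shiftedSymplectic P Q + shiftedSymplectic P Q' := by
  simp only [shiftedSymplectic, Prod.fst_add, Prod.snd_add, Pi.add_apply, mul_add,
    Finset.sum_add_distrib]
  abel

theorem shiftedSymplectic_smul_left (a : BinLaurent) (P Q : PauliSeq ι) :
    shiftedSymplectic (a • P) Q = invert a * shiftedSymplectic P Q := by
  simp only [shiftedSymplectic, Prod.smul_fst, Prod.smul_snd, Pi.smul_apply, smul_eq_mul, map_mul,
    Finset.mul_sum, mul_add, mul_assoc]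

theorem shiftedSymplectic_smul_right (a : BinLaurent) (P Q : PauliSeq ι) :
    shiftedSymplectic P (a • Q) = a * shiftedSymplectic P Q := by
  simp only [shiftedSymplectic, Prod.smul_fst, Prod.smul_snd, Pi.smul_apply, smul_eq_mul,
    Finset.mul_sum, mul_add, mul_left_comm a]

theorem shiftedSymplectic_zero_left (Q : PauliSeq ι) : shiftedSymplectic 0 Q = 0 := by
  simp [shiftedSymplectic]

theorem shiftedSymplectic_zero_right (P : PauliSeq ι) : shiftedSymplectic P 0 = 0 := by
  simp [shiftedSymplectic]

theorem shiftedSymplectic_sum_smul_left {σ : Type*} (s : Finset σ) (a : σ → BinLaurent)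
    (P : σ → PauliSeq ι) (Q : PauliSeq ι) :
    shiftedSymplectic (∑ i ∈ s, a i • P i) Q =
      ∑ i ∈ s, invert (a i) * shiftedSymplectic (P i) Q := by
  classical
  induction s using Finset.induction_on with
  | empty => simp [shiftedSymplectic_zero_left]
  | insert i s hi ih =>
    rw [Finset.sum_insert hi, Finset.sum_insert hi, shiftedSymplectic_add_left, ih,
      shiftedSymplectic_smul_left]

theorem shiftedSymplectic_sum_smul_right {σ : Type*} (s : Finset σ) (a : σ → BinLaurent)
    (P : PauliSeq ι) (Q : σ → PauliSeq ι) :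
    shiftedSymplectic P (∑ i ∈ s, a i • Q i) = ∑ i ∈ s, a i * shiftedSymplectic P (Q i) := by
  classical
  induction s using Finset.induction_on with
  | empty => simp [shiftedSymplectic_zero_right]
  | insert i s hi ih =>
    rw [Finset.sum_insert hi, Finset.sum_insert hi, shiftedSymplectic_add_right, ih,
      shiftedSymplectic_smul_right]

theorem shiftedSymplectic_pauliZ_left [DecidableEq ι] (q : ι) (Q : PauliSeq ι) :
    shiftedSymplectic (pauliZ q) Q = Q.2 q := by
  simp [shiftedSymplectic, pauliZ, Pi.single_apply, apply_ite]

theorem shiftedSymplectic_pauliX_left [DecidableEq ι] (q : ι) (Q : PauliSeq ι) :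
    shiftedSymplectic (pauliX q) Q = Q.1 q := by
  simp [shiftedSymplectic, pauliX, Pi.single_apply, apply_ite]

theorem Gate.shiftedSymplectic_act [DecidableEq ι] (g : Gate ι) (P Q : PauliSeq ι) :
    shiftedSymplectic (g.act P) (g.act Q) = shiftedSymplectic P Q := by
  have hT : ∀ k : ℤ, (T (-k) : BinLaurent) * T k = 1 := fun k => by rw [← T_add]; simp
  cases g with
  | cnot i j hij k =>
    have key : ∀ F : ι → BinLaurent,
        ∑ q, F q = F i + F j + ∑ q ∈ (Finset.univ.erase i).erase j, F q := fun F => by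
      rw [← Finset.add_sum_erase _ F (Finset.mem_univ i),
        ← Finset.add_sum_erase _ F (Finset.mem_erase.2 ⟨hij.symm, Finset.mem_univ j⟩), add_assoc]
    simp only [shiftedSymplectic]
    rw [key, key fun q => invert (P.1 q) * Q.2 q + invert (P.2 q) * Q.1 q]
    congr 1
    · simp only [Gate.act_cnot_fst, Gate.act_cnot_snd, Function.update_self,
        Function.update_of_ne hij, Function.update_of_ne hij.symm, map_add, map_mul, invert_T,
        neg_neg]
      have h1 := binLaurent_add_self (T k * invert (P.1 j) * Q.2 i)
      have h2 := binLaurent_add_self (T (-k) * invert (P.2 i) * Q.1 j)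
      linear_combination h1 + h2
    · refine Finset.sum_congr rfl fun q hq => ?_
      have hqj := (Finset.mem_erase.1 hq).1
      have hqi := (Finset.mem_erase.1 (Finset.mem_erase.1 hq).2).1
      simp only [Gate.act_cnot_fst, Gate.act_cnot_snd, Function.update_of_ne hqi,
        Function.update_of_ne hqj]
  | hadamard i =>
    refine Finset.sum_congr rfl fun q _ => ?_
    simp only [Gate.act_hadamard_fst, Gate.act_hadamard_snd, Function.update_apply]
    split_ifs with h
    · rw [h, add_comm]
    · rfl
  | swap i j =>
    exact Equiv.sum_comp (Equiv.swap i j)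
      fun q => invert (P.1 q) * Q.2 q + invert (P.2 q) * Q.1 q
  | delay i l =>
    refine Finset.sum_congr rfl fun q _ => ?_
    simp only [Gate.act_delay_fst, Gate.act_delay_snd, Function.update_apply]
    split_ifs with h
    · simp only [h, map_mul, invert_T]
      linear_combination (invert (P.1 i) * Q.2 i + invert (P.2 i) * Q.1 i) * hT l
    · rfl

theorem Circuit.shiftedSymplectic_act [DecidableEq ι] (C : Circuit ι) (P Q : PauliSeq ι) :
    shiftedSymplectic (Circuit.act C P) (Circuit.act C Q) = shiftedSymplectic P Q := by
  induction C generalizing P Q with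
  | nil => rfl
  | cons g C ih => rw [Circuit.act_cons, Circuit.act_cons, ih, Gate.shiftedSymplectic_act]

end Circuits

/-! ### Primitive families of vectors -/

section Primitive

variable {R M N σ τ : Type*} [CommRing R] [AddCommGroup M] [Module R M] [AddCommGroup N]
  [Module R N] [Fintype σ] [Fintype τ]

/-- A finite family of vectors is primitive if a linear combination of it is divisible by a nonzero
scalar only when all its coefficients are.  In a torsion-free module over a domain that is not a
field, this says that the family is linearly independent and that the quotient by its span is
torsion-free. -/
def IsPrimitiveFamily (R : Type*) {M σ : Type*} [CommRing R] [AddCommGroup M] [Module R M]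
    [Fintype σ] (a : σ → M) : Prop :=
  ∀ d : R, d ≠ 0 → ∀ (u : σ → R) (w : M), ∑ i, u i • a i = d • w → ∀ i, d ∣ u i

theorem IsPrimitiveFamily.map {a : σ → M} (ha : IsPrimitiveFamily R a) (e : M →ₗ[R] N)
    (e' : N →ₗ[R] M) (h : ∀ i, e' (e (a i)) = a i) : IsPrimitiveFamily R fun i => e (a i) := by
  intro d hd u w huw
  refine ha d hd u (e' w) ?_
  simpa [h] using congrArg e' huw

theorem IsPrimitiveFamily.comp_injective {a : σ → M} (ha : IsPrimitiveFamily R a) {f : τ → σ}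
    (hf : Function.Injective f) : IsPrimitiveFamily R fun j => a (f j) := by
  intro d hd u w huw j
  have := ha d hd (Function.extend f u 0) w ?_ (f j)
  · rwa [hf.extend_apply] at this
  · rw [← huw]
    refine (Fintype.sum_of_injective f hf _ _ (fun i hi => ?_) fun j => ?_).symm
    · rw [Function.extend_apply' _ _ _ (by simpa using hi)]
      simp
    · rw [hf.extend_apply]

/-- The linear combinations of a family whose coefficients are the rows of a matrix. -/
def rowCombination (A : Matrix σ σ R) (a : σ → M) (i : σ) : M := ∑ l, A i l • a l

theorem sum_smul_rowCombination (A : Matrix σ σ R) (a : σ → M) (u : σ → R) :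
    ∑ i, u i • rowCombination A a i = ∑ l, (Matrix.vecMul u A) l • a l := by
  simp only [rowCombination, Finset.smul_sum, smul_smul, Matrix.vecMul, dotProduct,
    Finset.sum_smul]
  exact Finset.sum_comm

theorem IsPrimitiveFamily.rowCombination [DecidableEq σ] {a : σ → M}
    (ha : IsPrimitiveFamily R a) {A A' : Matrix σ σ R} (h : A * A' = 1) :
    IsPrimitiveFamily R (rowCombination A a) := by
  intro d hd u w huw i
  rw [sum_smul_rowCombination] at huw
  have hdvd := ha d hd _ w huw
  have : u = Matrix.vecMul (Matrix.vecMul u A) A' := by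
    rw [Matrix.vecMul_vecMul, h, Matrix.vecMul_one]
  rw [this]
  exact Finset.dvd_sum fun l _ => (hdvd l).mul_right _

theorem rowCombination_mem_span (A : Matrix σ σ R) (a : σ → M) (i : σ) :
    rowCombination A a i ∈ Submodule.span R (Set.range a) :=
  Submodule.sum_mem _ fun l _ =>
    Submodule.smul_mem _ _ (Submodule.subset_span (Set.mem_range_self l))

theorem rowCombination_rowCombination (A A' : Matrix σ σ R) (a : σ → M) :
    rowCombination A (rowCombination A' a) = rowCombination (A * A') a :=
  funext fun i => sum_smul_rowCombination A' a (A i)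

theorem rowCombination_one [DecidableEq σ] (a : σ → M) : rowCombination (1 : Matrix σ σ R) a = a := by
  funext i
  simp [rowCombination, Matrix.one_apply]

theorem span_range_rowCombination [DecidableEq σ] {A A' : Matrix σ σ R} (h : A' * A = 1)
    (a : σ → M) :
    Submodule.span R (Set.range (rowCombination A a)) = Submodule.span R (Set.range a) := by
  refine le_antisymm (Submodule.span_le.2 ?_) (Submodule.span_le.2 ?_)
  · rintro _ ⟨i, rfl⟩
    exact rowCombination_mem_span A a i
  · rintro _ ⟨i, rfl⟩
    have := rowCombination_mem_span A' (rowCombination A a) i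
    rwa [rowCombination_rowCombination, h, rowCombination_one] at this

end Primitive

/-! ### Binary Laurent polynomials -/

theorem T_mul_T_neg (l : ℤ) : (T l * T (-l) : BinLaurent) = 1 := by
  rw [← T_add, add_neg_cancel, T_zero]

theorem T_neg_mul_T (l : ℤ) : (T (-l) * T l : BinLaurent) = 1 := by
  rw [← T_add, neg_add_cancel, T_zero]

theorem binPolynomial_eq_one_of_isUnit {p : (ZMod 2)[X]} (h : IsUnit p) : p = 1 := by
  obtain ⟨a, ha, rfl⟩ := Polynomial.isUnit_iff.1 h
  have : ∀ a : ZMod 2, a ≠ 0 → a = 1 := by decide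
  rw [this a ha.ne_zero, Polynomial.C_1]

/-- The units of the binary Laurent polynomials are the powers of `D`. -/
theorem exists_eq_T_of_isUnit {d : BinLaurent} (hd : IsUnit d) : ∃ l : ℤ, d = T l := by
  obtain ⟨e, he⟩ := hd.exists_right_inv
  obtain ⟨k, p, hp⟩ := exists_T_pow d
  obtain ⟨m, q, hq⟩ := exists_T_pow e
  have hpq : p * q = X ^ (k + m) := by
    apply Polynomial.toLaurent_injective
    rw [map_mul, hp, hq, Polynomial.toLaurent_X_pow, Nat.cast_add, T_add]
    linear_combination (T (k : ℤ) * T (m : ℤ)) * he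
  obtain ⟨i, -, u, hu⟩ := (dvd_prime_pow Polynomial.prime_X _).1 (Dvd.intro q hpq)
  rw [binPolynomial_eq_one_of_isUnit u.isUnit, mul_one] at hu
  refine ⟨(i : ℤ) - k, ?_⟩
  rw [hu, Polynomial.toLaurent_X_pow] at hp
  rw [sub_eq_add_neg, T_add, hp, mul_assoc, T_mul_T_neg, mul_one]

theorem one_add_T_ne_T (l : ℤ) : (1 + T 1 : BinLaurent) ≠ T l := by
  intro hl
  have h (t : ℤ) := congrArg (fun f : BinLaurent => f.coeff t) hl
  rw [← T_zero] at h
  have h0 := h 0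
  have h1 := h 1
  simp only [AddMonoidAlgebra.coeff_add, Finsupp.add_apply, T_apply] at h0 h1
  by_cases hl0 : l = 0 <;> by_cases hl1 : l = 1 <;> simp_all

theorem not_isUnit_one_add_T : ¬ IsUnit (1 + T 1 : BinLaurent) := fun h =>
  let ⟨l, hl⟩ := exists_eq_T_of_isUnit h
  one_add_T_ne_T l hl

theorem one_add_T_ne_zero : (1 + T 1 : BinLaurent) ≠ 0 := by
  intro h
  have h1 := congrArg (fun f : BinLaurent => f.coeff 1) h
  rw [← T_zero] at h1
  simp only [AddMonoidAlgebra.coeff_add, Finsupp.add_apply, T_apply] at h1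
  simp at h1

/-- Finitely many Laurent polynomials have a common denominator. -/
theorem exists_toLaurent_eq_T_mul {σ : Type*} [Finite σ] (u : σ → BinLaurent) :
    ∃ (k : ℕ) (v : σ → (ZMod 2)[X]), ∀ i, toLaurent (v i) = T k * u i := by
  have := Fintype.ofFinite σ
  choose k v hv using fun i => exists_T_pow (u i)
  refine ⟨∑ i, k i, fun i => X ^ (∑ j, k j - k i) * v i, fun i => ?_⟩
  have hle : k i ≤ ∑ j, k j := Finset.single_le_sum (fun _ _ => Nat.zero_le _) (Finset.mem_univ i)
  rw [map_mul, hv, Polynomial.toLaurent_X_pow, Nat.cast_sub hle, ← T_mul (k i), ← mul_assoc,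
    ← T_add, sub_add_cancel]

/-- A nonzero Laurent polynomial is a power of `D` times a polynomial with nonzero constant
coefficient. -/
theorem exists_eq_T_mul_toLaurent {d : BinLaurent} (hd : d ≠ 0) :
    ∃ (l : ℤ) (p : (ZMod 2)[X]), p.coeff 0 ≠ 0 ∧ d = T l * toLaurent p := by
  obtain ⟨k, p, hp⟩ := exists_T_pow d
  have hp0 : p ≠ 0 := by
    rintro rfl
    rw [map_zero] at hp
    exact hd (by rw [← mul_one d, ← T_mul_T_neg k, ← mul_assoc, ← hp, zero_mul])
  obtain ⟨q, hpq, hq⟩ := Polynomial.exists_eq_pow_rootMultiplicity_mul_and_not_dvd p hp0 0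
  rw [Polynomial.C_0, sub_zero] at hpq hq
  refine ⟨(p.rootMultiplicity 0 : ℤ) - k, q, fun h => hq (Polynomial.X_dvd_iff.2 h), ?_⟩
  rw [hpq, map_mul, Polynomial.toLaurent_X_pow] at hp
  calc d = d * T k * T (-k) := by rw [mul_assoc, T_mul_T_neg, mul_one]
    _ = _ := by rw [← hp, sub_eq_add_neg, T_add]; ring

theorem exists_coe_eq_of_finite {φ : PowerSeries (ZMod 2)}
    (h : {t : ℕ | PowerSeries.coeff t φ ≠ 0}.Finite) :
    ∃ q : (ZMod 2)[X], (q : PowerSeries (ZMod 2)) = φ := by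
  obtain ⟨N, hN⟩ := h.bddAbove
  refine ⟨PowerSeries.trunc (N + 1) φ, PowerSeries.ext fun t => ?_⟩
  rw [Polynomial.coeff_coe, PowerSeries.coeff_trunc]
  split_ifs with ht
  · rfl
  · by_contra hne
    exact ht (Nat.lt_succ_of_le (hN (Ne.symm hne)))

/-- The rows of a noncatastrophic matrix form a primitive family over the Laurent polynomials:
if a polynomial `p` with `p(0) ≠ 0` divides `v H`, then the power series `v / p` is sent to a
polynomial vector, hence is itself a polynomial vector. -/
theorem IsNoncatastrophic.isPrimitiveFamily {r n : ℕ} {H : Matrix (Fin r) (Fin n) (ZMod 2)[X]}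
    (hH : IsNoncatastrophic H) :
    IsPrimitiveFamily BinLaurent fun (i : Fin r) (j : Fin n) => toLaurent (H i j) := by
  intro d hd u w huw i
  obtain ⟨l, p, hp0, rfl⟩ := exists_eq_T_mul_toLaurent hd
  obtain ⟨k, v, hv⟩ := exists_toLaurent_eq_T_mul (Sum.elim u fun j => T l * w j)
  have hpoly : ∀ j, ∑ i, v (Sum.inl i) * H i j = p * v (Sum.inr j) := fun j => by
    apply Polynomial.toLaurent_injective
    have := congrFun huw j
    simp only [Finset.sum_apply, Pi.smul_apply, smul_eq_mul] at this
    simp only [map_sum, map_mul, hv, Sum.elim_inl, Sum.elim_inr, mul_assoc, ← Finset.mul_sum]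
    rw [this]
    ring
  have hc : PowerSeries.constantCoeff (p : PowerSeries (ZMod 2)) ≠ 0 := by
    rwa [← PowerSeries.coeff_zero_eq_constantCoeff_apply, Polynomial.coeff_coe]
  have hinv := PowerSeries.mul_inv_cancel (p : PowerSeries (ZMod 2)) hc
  have hfin := hH (fun i => (v (Sum.inl i) : PowerSeries (ZMod 2)) * (p : PowerSeries (ZMod 2))⁻¹)
    (fun j => by
      have hj : ∑ i, (v (Sum.inl i) : PowerSeries (ZMod 2)) * (p : PowerSeries (ZMod 2))⁻¹ *
          (H i j : PowerSeries (ZMod 2)) = (v (Sum.inr j) : PowerSeries (ZMod 2)) := by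
        have := congrArg (fun q : (ZMod 2)[X] => (q : PowerSeries (ZMod 2))) (hpoly j)
        simp only [← Polynomial.coeToPowerSeries.ringHom_apply, map_sum, map_mul] at this ⊢
        simp only [Polynomial.coeToPowerSeries.ringHom_apply] at this ⊢
        calc _ = (∑ i, (v (Sum.inl i) : PowerSeries (ZMod 2)) * (H i j : PowerSeries (ZMod 2))) *
              (p : PowerSeries (ZMod 2))⁻¹ := by
              rw [Finset.sum_mul]
              exact Finset.sum_congr rfl fun i _ => by ring
          _ = _ := by
              rw [this, mul_right_comm, hinv, one_mul]
      rw [hj]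
      refine (v (Sum.inr j)).support.finite_toSet.subset fun t ht => ?_
      simpa using ht) i
  obtain ⟨q, hq⟩ := exists_coe_eq_of_finite hfin
  have hvq : v (Sum.inl i) = p * q := by
    apply Polynomial.coe_injective
    rw [Polynomial.coe_mul, hq, mul_left_comm, hinv, mul_one]
  have hu : u i = T (-k) * toLaurent (v (Sum.inl i)) := by
    rw [hv, ← mul_assoc, T_neg_mul_T, one_mul]; rfl
  refine ⟨T (-l) * T (-k) * toLaurent q, ?_⟩
  rw [hu, hvq, map_mul]
  linear_combination -(T (-k) * toLaurent p * toLaurent q) * T_mul_T_neg l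

/-! ### Elementary circuits -/

section Elementary

variable {ι : Type} [DecidableEq ι]

/-- Hadamard gates on a set of qubits. -/
theorem exists_circuit_hadamard (s : Finset ι) :
    ∃ C : Circuit ι, ∀ P : PauliSeq ι,
      Circuit.act C P = (s.piecewise P.2 P.1, s.piecewise P.1 P.2) := by
  induction s using Finset.induction_on with
  | empty => exact ⟨[], fun P => by simp [Circuit.act_nil]⟩
  | insert i s hi ih =>
    obtain ⟨C, hC⟩ := ih
    refine ⟨C ++ [Gate.hadamard i], fun P => ?_⟩
    rw [Circuit.act_append, Circuit.act_cons, Circuit.act_nil, hC]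
    refine Prod.ext ?_ ?_
    · rw [Gate.act_hadamard_fst]
      simp only [Finset.piecewise_insert, Finset.piecewise_eq_of_notMem _ _ _ hi]
    · rw [Gate.act_hadamard_snd]
      simp only [Finset.piecewise_insert, Finset.piecewise_eq_of_notMem _ _ _ hi]

variable [Fintype ι]

/-- Some circuit without Hadamard gates adds to a `Z` part its value at `k` times the vector `v`.
The `X` part is transformed contragrediently. -/
def RealizesTransvection (k : ι) (v : ι → BinLaurent) : Prop :=
  ∃ C : Circuit ι, Circuit.HadamardFree C ∧ ∀ P : PauliSeq ι,
    Circuit.act C P = (P.1 + P.1 k • v, P.2 + Pi.single k (∑ q, invert (v q) * P.2 q))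

theorem RealizesTransvection.zero (k : ι) : RealizesTransvection k 0 :=
  ⟨[], .nil, fun P => by simp [Circuit.act_nil]⟩

theorem RealizesTransvection.add {k : ι} {v w : ι → BinLaurent} (hvk : v k = 0) (hwk : w k = 0)
    (hv : RealizesTransvection k v) (hw : RealizesTransvection k w) :
    RealizesTransvection k (v + w) := by
  obtain ⟨C, hC, hCv⟩ := hv
  obtain ⟨C', hC', hCw⟩ := hw
  refine ⟨C ++ C', hC.append hC', fun P => ?_⟩
  rw [Circuit.act_append, hCv, hCw]
  have hsum : ∀ a : BinLaurent, ∑ q, invert (w q) * (P.2 + Pi.single k a : ι → BinLaurent) q =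
      ∑ q, invert (w q) * P.2 q := by
    intro a
    refine Finset.sum_congr rfl fun q _ => ?_
    by_cases hq : q = k
    · rw [hq, hwk, map_zero, zero_mul, zero_mul]
    · rw [Pi.add_apply, Pi.single_eq_of_ne hq, add_zero]
  refine Prod.ext ?_ ?_
  · simp only [Pi.add_apply, Pi.smul_apply, hvk, smul_zero, add_zero, smul_add, add_assoc]
  · simp only [hsum]
    simp only [Pi.add_apply, map_add, add_mul, Finset.sum_add_distrib, Pi.single_add, add_assoc]

theorem RealizesTransvection.single {k q : ι} (hq : q ≠ k) (f : BinLaurent) :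
    RealizesTransvection k (Pi.single q f) := by
  induction f using LaurentPolynomial.induction_on' with
  | add f g hf hg =>
    rw [Pi.single_add]
    exact hf.add (Pi.single_eq_of_ne hq.symm _) (Pi.single_eq_of_ne hq.symm _) hg
  | C_mul_T l a =>
    have ha : a = 0 ∨ a = 1 := by revert a; decide
    rcases ha with rfl | rfl
    · rw [map_zero, zero_mul, Pi.single_zero]
      exact .zero k
    · refine ⟨[Gate.cnot q k hq (-l)], Circuit.HadamardFree.nil.cons (by simp), fun P => ?_⟩
      rw [Circuit.act_cons, Circuit.act_nil, map_one, one_mul]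
      refine Prod.ext ?_ ?_ <;> funext p
      · rw [Gate.act_cnot_fst, Function.update_apply, neg_neg]
        split_ifs with hp
        · dsimp only
          rw [hp, Pi.add_apply, Pi.smul_apply, Pi.single_eq_same, smul_eq_mul, mul_comm (T l)]
        · dsimp only
          rw [Pi.add_apply, Pi.smul_apply, Pi.single_eq_of_ne hp, smul_zero, add_zero]
      · have hsum : ∑ p, invert ((Pi.single q (T l) : ι → BinLaurent) p) * P.2 p =
            T (-l) * P.2 q := by
          rw [Finset.sum_eq_single q (fun p _ hp => by
            rw [Pi.single_eq_of_ne hp, map_zero, zero_mul]) (by simp),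
            Pi.single_eq_same, invert_T]
        rw [hsum, Gate.act_cnot_snd, Function.update_apply]
        split_ifs with hp
        · dsimp only
          rw [hp, Pi.add_apply, Pi.single_eq_same]
        · dsimp only
          rw [Pi.add_apply, Pi.single_eq_of_ne hp, add_zero]

theorem RealizesTransvection.sum {k : ι} (v : ι → BinLaurent) {s : Finset ι} (hk : k ∉ s) :
    RealizesTransvection k (∑ q ∈ s, Pi.single q (v q)) := by
  induction s using Finset.induction_on with
  | empty => exact .zero k
  | insert q s hq ih =>
    rw [Finset.mem_insert, not_or] at hk
    rw [Finset.sum_insert hq]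
    have h0 : (∑ q ∈ s, Pi.single q (v q) : ι → BinLaurent) k = 0 := by
      rw [Finset.sum_apply]
      exact Finset.sum_eq_zero fun p hp =>
        Pi.single_eq_of_ne (M := fun _ => BinLaurent) (fun h => hk.2 (by rwa [h])) _
    exact (RealizesTransvection.single (Ne.symm hk.1) _).add
      (Pi.single_eq_of_ne (M := fun _ => BinLaurent) hk.1 _) h0 (ih hk.2)

theorem realizesTransvection (k : ι) (v : ι → BinLaurent) (hv : v k = 0) :
    RealizesTransvection k v := by
  have hsum : ∑ q ∈ Finset.univ.erase k, (Pi.single q (v q) : ι → BinLaurent) = v := by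
    rw [Finset.sum_erase _ (by rw [hv, Pi.single_zero]), Finset.univ_sum_single]
  rw [← hsum]
  exact .sum v (Finset.notMem_erase k _)

/-- Simultaneous transvections with targets in `s`; they commute, since the vectors `v j` vanish
on `s`. -/
theorem exists_circuit_transvections (s : Finset ι) (v : ι → ι → BinLaurent)
    (hv : ∀ j ∈ s, ∀ q ∈ s, v j q = 0) :
    ∃ C : Circuit ι, ∀ P : PauliSeq ι, Circuit.act C P =
        (P.1 + ∑ j ∈ s, P.1 j • v j,
          P.2 + ∑ j ∈ s, Pi.single j (∑ q, invert (v j q) * P.2 q)) := by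
  induction s using Finset.induction_on with
  | empty => exact ⟨[], fun P => by simp [Circuit.act_nil]⟩
  | insert k s hk ih =>
    obtain ⟨C, hC⟩ := ih fun j hj q hq =>
      hv j (Finset.mem_insert_of_mem hj) q (Finset.mem_insert_of_mem hq)
    obtain ⟨C', -, hC'⟩ := realizesTransvection k (v k)
      (hv k (Finset.mem_insert_self k s) k (Finset.mem_insert_self k s))
    refine ⟨C ++ C', fun P => ?_⟩
    rw [Circuit.act_append, hC, hC', Finset.sum_insert hk, Finset.sum_insert hk]
    refine Prod.ext ?_ ?_
    · have h0 : (P.1 + ∑ j ∈ s, P.1 j • v j) k = P.1 k := by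
        rw [Pi.add_apply, Finset.sum_apply, Finset.sum_eq_zero, add_zero]
        intro j hj
        rw [Pi.smul_apply, hv j (Finset.mem_insert_of_mem hj) k (Finset.mem_insert_self k s),
          smul_zero]
      simp only [h0]
      abel
    · have h0 : ∑ q, invert (v k q) *
          (P.2 + ∑ j ∈ s, Pi.single j (∑ q, invert (v j q) * P.2 q)) q =
            ∑ q, invert (v k q) * P.2 q := by
        refine Finset.sum_congr rfl fun q _ => ?_
        by_cases hq : q ∈ s
        · rw [hv k (Finset.mem_insert_self k s) q (Finset.mem_insert_of_mem hq)]
          simp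
        · rw [Pi.add_apply, Finset.sum_apply, Finset.sum_eq_zero, add_zero]
          intro j hj
          exact Pi.single_eq_of_ne (fun h => hq (by rwa [h])) _
      simp only [h0]
      abel

/-- The size of a polynomial in the Euclidean algorithm. -/
def euclideanWeight (p : (ZMod 2)[X]) : ℕ := if p = 0 then 0 else p.natDegree + 1

theorem euclideanWeight_add_lt {p q : (ZMod 2)[X]} (hp : p ≠ 0) (hq : q ≠ 0)
    (hqp : q.natDegree ≤ p.natDegree) :
    euclideanWeight (p + X ^ (p.natDegree - q.natDegree) * q) < euclideanWeight p := by
  have hlc : ∀ f : (ZMod 2)[X], f ≠ 0 → f.leadingCoeff = 1 := fun f hf => by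
    have : ∀ a : ZMod 2, a ≠ 0 → a = 1 := by decide
    exact this _ (Polynomial.leadingCoeff_ne_zero.2 hf)
  have hXq : X ^ (p.natDegree - q.natDegree) * q ≠ 0 :=
    mul_ne_zero (pow_ne_zero _ Polynomial.X_ne_zero) hq
  have hdeg : (X ^ (p.natDegree - q.natDegree) * q).natDegree = p.natDegree := by
    rw [Polynomial.natDegree_mul (pow_ne_zero _ Polynomial.X_ne_zero) hq,
      Polynomial.natDegree_X_pow, Nat.sub_add_cancel hqp]
  have hlt : (p + X ^ (p.natDegree - q.natDegree) * q).degree < p.degree := by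
    rw [← CharTwo.sub_eq_add]
    refine Polynomial.degree_sub_lt_left ?_ hp (by rw [hlc p hp, hlc _ hXq])
    rw [Polynomial.degree_eq_natDegree hp, Polynomial.degree_eq_natDegree hXq, hdeg]
  rw [euclideanWeight, euclideanWeight, if_neg hp]
  split_ifs with h
  · omega
  · have := Polynomial.natDegree_lt_natDegree h hlt
    omega

/-- The Euclidean algorithm by CNOTs: the total degree of a polynomial vector decreases as long as
two entries are nonzero, since over `ZMod 2` a shift of one of them cancels the leading term of the
other. -/
theorem exists_circuit_euclid (i₀ : ι) (p : ι → (ZMod 2)[X]) :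
    ∃ C : Circuit ι, Circuit.HadamardFree C ∧ ∃ d : BinLaurent,
      Circuit.act C (fun i => toLaurent (p i), 0) = (Pi.single i₀ d, 0) := by
  induction hN : ∑ i, euclideanWeight (p i) using Nat.strong_induction_on generalizing p with
  | _ N ih =>
  subst hN
  by_cases h : ∃ i j, i ≠ j ∧ p i ≠ 0 ∧ p j ≠ 0 ∧ (p j).natDegree ≤ (p i).natDegree
  · obtain ⟨i, j, hij, hi, hj, hle⟩ := h
    set k := (p i).natDegree - (p j).natDegree
    have hlt : ∑ l, euclideanWeight (Function.update p i (p i + X ^ k * p j) l) <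
        ∑ l, euclideanWeight (p l) := by
      have hi' := euclideanWeight_add_lt hi hj hle
      refine Finset.sum_lt_sum (fun l _ => ?_) ⟨i, Finset.mem_univ i, ?_⟩
      · rw [Function.update_apply]
        split_ifs with hl
        · rw [hl]; exact hi'.le
        · exact le_rfl
      · rwa [Function.update_self]
    obtain ⟨C, hC, d, hd⟩ := ih _ hlt _ rfl
    refine ⟨Gate.cnot i j hij (-k) :: C, hC.cons (by simp), d, ?_⟩
    rw [Circuit.act_cons, ← hd]
    congr 1
    refine Prod.ext ?_ ?_ <;> funext l
    · rw [Gate.act_cnot_fst]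
      by_cases hl : l = i
      · subst hl; simp [Polynomial.toLaurent_X_pow]
      · simp [hl]
    · rw [Gate.act_cnot_snd]
      simp
  · by_cases hp : ∃ i, p i ≠ 0
    · obtain ⟨i, hi⟩ := hp
      have hz : ∀ l, l ≠ i → p l = 0 := fun l hl => by
        by_contra hl0
        rcases le_total (p l).natDegree (p i).natDegree with hle | hle
        · exact h ⟨i, l, hl.symm, hi, hl0, hle⟩
        · exact h ⟨l, i, hl, hl0, hi, hle⟩
      refine ⟨[Gate.swap i i₀], Circuit.HadamardFree.nil.cons (by simp), toLaurent (p i), ?_⟩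
      rw [Circuit.act_cons, Circuit.act_nil]
      refine Prod.ext ?_ (by rw [Gate.act_swap_snd]; rfl)
      funext l
      rw [Gate.act_swap_fst, Function.comp_apply]
      by_cases hl : l = i₀
      · subst hl; simp
      · have : Equiv.swap i i₀ l ≠ i := fun h' => hl (by
          rw [Equiv.swap_apply_eq_iff, Equiv.swap_apply_left] at h'
          exact h')
        simp [hl, hz _ this]
    · push Not at hp
      exact ⟨[], .nil, 0, by simp [Circuit.act_nil, hp]; rfl⟩

/-- A finite-depth circuit without Hadamard gates concentrates a `Z` type sequence on one qubit. -/
theorem exists_circuit_act_eq_single (i₀ : ι) (z : ι → BinLaurent) :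
    ∃ C : Circuit ι, Circuit.HadamardFree C ∧ ∃ d : BinLaurent,
      Circuit.act C (z, 0) = (Pi.single i₀ d, 0) := by
  obtain ⟨k, p, hp⟩ := exists_toLaurent_eq_T_mul z
  obtain ⟨C, hC, d, hd⟩ := exists_circuit_euclid i₀ p
  refine ⟨C, hC, T (-k) * d, ?_⟩
  have hz : ((z, 0) : PauliSeq ι) = (T (-k) : BinLaurent) • (fun i => toLaurent (p i), 0) := by
    refine Prod.ext ?_ (by simp)
    funext i
    simp only [Prod.smul_fst, Pi.smul_apply, smul_eq_mul, hp, ← mul_assoc, T_neg_mul_T, one_mul]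
  rw [hz, map_smul, hd]
  refine Prod.ext ?_ (by simp)
  rw [Prod.smul_fst, ← smul_eq_mul, Pi.single_smul]

end Elementary

/-! ### Reduction of primitive families by circuits -/

/-- If `d` divides a linear combination of a primitive family with a coefficient `1`, then `d` is
a unit.  This includes the case `d = 0`. -/
theorem IsPrimitiveFamily.isUnit {M σ : Type*} [AddCommGroup M] [Module BinLaurent M] [Fintype σ]
    {a : σ → M} (ha : IsPrimitiveFamily BinLaurent a) {d : BinLaurent} {u : σ → BinLaurent} {w : M}
    (h : ∑ i, u i • a i = d • w) {i : σ} (hi : u i = 1) : IsUnit d := by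
  by_cases hd : d = 0
  · -- The combination vanishes, so it is divisible by the non-unit `1 + D` as well.
    have := ha (1 + T 1) one_add_T_ne_zero u 0 (by rw [h, hd, zero_smul, smul_zero]) i
    rw [hi] at this
    exact absurd (isUnit_of_dvd_one this) not_isUnit_one_add_T
  · have := ha d hd u w h i
    rw [hi] at this
    exact isUnit_of_dvd_one this

theorem IsPrimitiveFamily.act {ι σ : Type} [DecidableEq ι] [Fintype σ] {a : σ → PauliSeq ι}
    (ha : IsPrimitiveFamily BinLaurent a) (C : Circuit ι) :
    IsPrimitiveFamily BinLaurent fun i => Circuit.act C (a i) :=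
  ha.map (Circuit.act C) (Circuit.act (Circuit.inv C)) fun i => Circuit.act_inv_act C (a i)

/-- If the members of index below `k` of a primitive family are the first standard vectors, and the
member of index `k` vanishes beyond `k`, then the entry of the latter at `k` is a unit; in
particular there is such an entry. -/
theorem IsPrimitiveFamily.isUnit_of_triangular {n r k : ℕ} {a : Fin r → PauliSeq (Fin n)}
    (ha : IsPrimitiveFamily BinLaurent a) (hkr : k < r) (hkn : k ≤ n)
    (hlt : ∀ (i : Fin r) (q : Fin n), i.val < k → q.val = i.val → a i = pauliZ q)
    (hsnd : (a ⟨k, hkr⟩).2 = 0) {d : BinLaurent} {w : Fin n → BinLaurent}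
    (htail : ∀ q : Fin n, k ≤ q.val → (a ⟨k, hkr⟩).1 q = d * w q) : IsUnit d := by
  set v := (a ⟨k, hkr⟩).1 with hv
  have hk : a ⟨k, hkr⟩ = (v, 0) := Prod.ext hv.symm hsnd
  -- Subtract the combination of the earlier members that cancels the entries before `k`.
  refine ha.isUnit (u := fun i => if h : i.val < k then v ⟨i, h.trans_le hkn⟩ else
    if i.val = k then 1 else 0) (w := (fun q => if q.val < k then 0 else w q, 0))
    (i := ⟨k, hkr⟩) ?_ (by simp)
  have hterm : ∀ i : Fin r, (if h : i.val < k then v ⟨i, h.trans_le hkn⟩ else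
      if i.val = k then 1 else 0) • a i =
      ((fun q : Fin n => (if i.val = q.val ∧ q.val < k then v q else 0) +
        if i = ⟨k, hkr⟩ then v q else 0, 0) : PauliSeq (Fin n)) := by
    intro i
    rcases lt_trichotomy i.val k with h | h | h
    · have hne : i ≠ ⟨k, hkr⟩ := fun h' => by simp [h'] at h
      rw [dif_pos h, hlt i ⟨i, h.trans_le hkn⟩ h rfl]
      refine Prod.ext ?_ (by simp [pauliZ])
      funext q
      simp only [pauliZ, Prod.smul_fst, Pi.smul_apply, smul_eq_mul, if_neg hne, add_zero]
      by_cases hq : q = ⟨i, h.trans_le hkn⟩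
      · subst hq; simp [h]
      · have : ¬ (i.val = q.val ∧ q.val < k) := fun h' => hq (Fin.ext h'.1.symm)
        simp [hq, this]
    · have hi : i = ⟨k, hkr⟩ := Fin.ext h
      subst hi
      rw [dif_neg (lt_irrefl _), if_pos rfl, one_smul, hk]
      refine Prod.ext ?_ rfl
      funext q
      have : ¬ (k = q.val ∧ q.val < k) := by omega
      simp [this]
    · have hne : i ≠ ⟨k, hkr⟩ := fun h' => by simp [h'] at h
      rw [dif_neg (by omega), if_neg (by omega), zero_smul]
      refine Prod.ext ?_ rfl
      funext q
      have : ¬ (i.val = q.val ∧ q.val < k) := by omega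
      simp [this, hne]
  rw [Finset.sum_congr rfl fun i _ => hterm i]
  refine Prod.ext ?_ (by simp [Prod.snd_sum])
  funext q
  simp only [Prod.fst_sum, Finset.sum_apply, Finset.sum_add_distrib, Finset.sum_ite_eq',
    Finset.mem_univ, if_true, Prod.smul_fst, Pi.smul_apply, smul_eq_mul]
  by_cases hq : q.val < k
  · rw [Finset.sum_eq_single (⟨q, hq.trans hkr⟩ : Fin r)]
    · simp [hq, binLaurent_add_self]
    · intro i _ hi
      exact if_neg fun h => hi (Fin.ext h.1)
    · simp
  · simp [hq, htail q (not_lt.1 hq)]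

/-- The qubits from `k` on. -/
def tailEmbedding (n k : ℕ) : {q : Fin n // k ≤ q.val} ↪ Fin n := Function.Embedding.subtype _

/-- One step of the reduction to standard vectors. -/
theorem exists_circuit_pauliZ_step {n r k : ℕ} {a : Fin r → PauliSeq (Fin n)}
    (ha : IsPrimitiveFamily BinLaurent a) (hkr : k < r) (hkn : k ≤ n)
    (hlt : ∀ (i : Fin r) (q : Fin n), i.val < k → q.val = i.val → a i = pauliZ q)
    (hsnd : (a ⟨k, hkr⟩).2 = 0) :
    k < n ∧ ∃ C : Circuit (Fin n), Circuit.HadamardFree C ∧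
      ∀ (i : Fin r) (q : Fin n), i.val < k + 1 → q.val = i.val →
        Circuit.act C (a i) = pauliZ q := by
  have hkn' : k < n := by
    by_contra h
    refine not_isUnit_zero (M₀ := BinLaurent)
      (ha.isUnit_of_triangular hkr hkn hlt hsnd (w := 0) fun q hq => ?_)
    exact absurd (hq.trans_lt q.isLt) h
  refine ⟨hkn', ?_⟩
  let f := tailEmbedding n k
  obtain ⟨C₁, hC₁, d, hd⟩ := exists_circuit_act_eq_single
    (⟨⟨k, hkn'⟩, le_rfl⟩ : {q : Fin n // k ≤ q.val}) ((a ⟨k, hkr⟩).1 ∘ f)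
  -- The Euclidean algorithm on the qubits from `k` on does not affect the earlier vectors.
  have hfix : ∀ (C : Circuit _) (q : Fin n), q.val < k →
      Circuit.act (Circuit.relabel f C) (pauliZ q) = pauliZ q := by
    intro C q hq
    refine Circuit.act_relabel_of_restrict_eq_zero f C (Prod.ext ?_ rfl)
    funext p
    refine Pi.single_eq_of_ne (M := fun _ => BinLaurent) (fun h => ?_) _
    have := p.2
    have h' : p.1 = q := h
    rw [h'] at this
    omega
  have ha₁ := ha.act (Circuit.relabel f C₁)
  have hsnd₁ : (Circuit.act (Circuit.relabel f C₁) (a ⟨k, hkr⟩)).2 = 0 :=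
    (hC₁.relabel f).act_snd_eq_zero hsnd
  have htail₁ : ∀ q : Fin n, k ≤ q.val →
      (Circuit.act (Circuit.relabel f C₁) (a ⟨k, hkr⟩)).1 q = if q.val = k then d else 0 := by
    intro q hq
    have h := Circuit.restrict_act_relabel f C₁ (a ⟨k, hkr⟩)
    rw [PauliSeq.restrict, PauliSeq.restrict, hsnd] at h
    have h' := congrFun (congrArg Prod.fst (h.trans hd)) ⟨q, hq⟩
    refine h'.trans ?_
    dsimp only
    rw [Pi.single_apply]
    exact if_congr (by rw [Subtype.ext_iff, Fin.ext_iff]) rfl rfl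
  obtain ⟨l, rfl⟩ := exists_eq_T_of_isUnit <| ha₁.isUnit_of_triangular hkr hkn
    (fun i q hi hq => by rw [hlt i q hi hq, hfix _ _ (hq ▸ hi)]) hsnd₁
    (w := fun q => if q.val = k then 1 else 0) (d := d)
    fun q hq => by rw [htail₁ q hq]; split_ifs <;> simp
  set v := (Circuit.act (Circuit.relabel f C₁) (a ⟨k, hkr⟩)).1 with hv
  -- Normalize the entry at `k` by a delay and clear the entries before it by CNOTs.
  obtain ⟨C₂, hC₂, hC₂v⟩ := realizesTransvection (⟨k, hkn'⟩ : Fin n)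
    (fun q => if q.val < k then v q else 0) (by simp)
  have hD : Circuit.HadamardFree [Gate.delay (⟨k, hkn'⟩ : Fin n) (-l)] :=
    Circuit.HadamardFree.nil.cons (by simp)
  refine ⟨Circuit.relabel f C₁ ++ ([Gate.delay ⟨k, hkn'⟩ (-l)] ++ C₂),
    (hC₁.relabel f).append (hD.append hC₂), fun i q hi hq => ?_⟩
  rw [Circuit.act_append, Circuit.act_append, Circuit.act_cons, Circuit.act_nil]
  rcases Nat.lt_succ_iff_lt_or_eq.1 hi with hi | hi
  · have hqk : q.val < k := hq ▸ hi
    have hqne : (⟨k, hkn'⟩ : Fin n) ≠ q := fun h => by simp [← h] at hqk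
    have hdelay : (Gate.delay (⟨k, hkn'⟩ : Fin n) (-l)).act (pauliZ q) = pauliZ q := by
      refine Prod.ext ?_ ?_
      · rw [Gate.act_delay_fst]
        exact Function.update_eq_self_iff.2 (by simp [pauliZ, hqne])
      · rw [Gate.act_delay_snd]
        exact Function.update_eq_self_iff.2 (by simp [pauliZ])
    rw [hlt i q hi hq, hfix _ _ hqk, hdelay, hC₂v]
    simp [pauliZ, hqne]
  · have hik : i = ⟨k, hkr⟩ := Fin.ext hi
    have hqk : q = ⟨k, hkn'⟩ := Fin.ext (hq.trans hi)
    have hmid : (Gate.delay (⟨k, hkn'⟩ : Fin n) (-l)).act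
        (Circuit.act (Circuit.relabel f C₁) (a i)) = (Function.update v ⟨k, hkn'⟩ 1, 0) := by
      refine Prod.ext ?_ ?_
      · rw [Gate.act_delay_fst, hik, ← hv]
        dsimp only
        rw [show v ⟨k, hkn'⟩ = T l by rw [htail₁ _ le_rfl, if_pos rfl], T_neg_mul_T]
      · rw [Gate.act_delay_snd, hik, hsnd₁]
        simp
    rw [hmid, hC₂v, hqk]
    refine Prod.ext ?_ (by simp [pauliZ])
    funext p
    rcases lt_trichotomy p.val k with h | h | h
    · have hp : p ≠ ⟨k, hkn'⟩ := fun h' => by simp [h'] at h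
      simp [pauliZ, h, hp, binLaurent_add_self]
    · have hp : p = ⟨k, hkn'⟩ := Fin.ext h
      subst hp
      simp [pauliZ]
    · have hp : p ≠ ⟨k, hkn'⟩ := fun h' => by simp [h'] at h
      have hvp : v p = 0 := by rw [htail₁ p h.le, if_neg h.ne']
      simp [pauliZ, h.not_gt, hp, hvp]

/-- A primitive family of `Z` type sequences is taken to the operators `Z` on the first qubits by a
circuit without Hadamard gates. -/
theorem IsPrimitiveFamily.exists_circuit_pauliZ {n r : ℕ} {a : Fin r → PauliSeq (Fin n)}
    (ha : IsPrimitiveFamily BinLaurent a) (hsnd : ∀ i, (a i).2 = 0) :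
    r ≤ n ∧ ∃ C : Circuit (Fin n), Circuit.HadamardFree C ∧
      ∀ (i : Fin r) (q : Fin n), q.val = i.val → Circuit.act C (a i) = pauliZ q := by
  have key : ∀ k ≤ r, k ≤ n ∧ ∃ C : Circuit (Fin n), Circuit.HadamardFree C ∧
      ∀ (i : Fin r) (q : Fin n), i.val < k → q.val = i.val →
        Circuit.act C (a i) = pauliZ q := by
    intro k
    induction k with
    | zero => exact fun _ => ⟨Nat.zero_le n, [], .nil, fun _ _ h => absurd h (Nat.not_lt_zero _)⟩
    | succ k ih =>
      intro hk
      obtain ⟨hkn, C, hC, hCa⟩ := ih (Nat.le_of_succ_le hk)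
      obtain ⟨hkn', C', hC', hCa'⟩ := exists_circuit_pauliZ_step (ha.act C) hk hkn hCa
        (hC.act_snd_eq_zero (hsnd _))
      refine ⟨hkn', C ++ C', hC.append hC', fun i q hi hq => ?_⟩
      rw [Circuit.act_append, hCa' i q hi hq]
  obtain ⟨hrn, C, hC, hCa⟩ := key r le_rfl
  exact ⟨hrn, C, hC, fun i q hq => hCa i q i.isLt hq⟩

/-- The embedding of `Fin (n - r)` into `Fin n` onto the qubits from `r` on. -/
def shiftEmbedding (n r : ℕ) : Fin (n - r) ↪ Fin n where
  toFun q := ⟨r + q, by omega⟩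
  inj' p q h := by simpa [Fin.ext_iff] using h

theorem mem_range_shiftEmbedding {n r : ℕ} {q : Fin n} :
    q ∈ Set.range (shiftEmbedding n r) ↔ r ≤ q.val := by
  constructor
  · rintro ⟨p, rfl⟩
    exact Nat.le_add_right _ _
  · intro h
    exact ⟨⟨q - r, by omega⟩, Fin.ext (Nat.add_sub_cancel' h)⟩

/-- A primitive family of `Z` type sequences supported on the qubits from `r` on is taken to the
operators `Z` on the qubits `r, r + 1, …` by a circuit that touches the qubits from `r` on only. -/
theorem IsPrimitiveFamily.exists_circuit_pauliZ_shift {n r t : ℕ} {b : Fin t → PauliSeq (Fin n)}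
    (hb : IsPrimitiveFamily BinLaurent b) (hsnd : ∀ j, (b j).2 = 0)
    (hfst : ∀ (j : Fin t) (q : Fin n), q.val < r → (b j).1 q = 0) :
    t ≤ n - r ∧ ∃ C : Circuit (Fin n),
      (∀ P : PauliSeq (Fin n), (∀ q : Fin n, r ≤ q.val → P.1 q = 0 ∧ P.2 q = 0) →
        Circuit.act C P = P) ∧
      ∀ (j : Fin t) (q : Fin n), q.val = r + j.val → Circuit.act C (b j) = pauliZ q := by
  let f := shiftEmbedding n r
  let e : PauliSeq (Fin n) →ₗ[BinLaurent] PauliSeq (Fin (n - r)) :=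
    (LinearMap.funLeft BinLaurent BinLaurent f).prodMap (LinearMap.funLeft BinLaurent BinLaurent f)
  let e' : PauliSeq (Fin (n - r)) →ₗ[BinLaurent] PauliSeq (Fin n) :=
    (Function.ExtendByZero.linearMap BinLaurent f).prodMap
      (Function.ExtendByZero.linearMap BinLaurent f)
  have hext : ∀ x : Fin n → BinLaurent, (∀ q : Fin n, q.val < r → x q = 0) →
      Function.extend f (x ∘ f) 0 = x := by
    intro x hx
    funext q
    by_cases hq : r ≤ q.val
    · obtain ⟨p, rfl⟩ := mem_range_shiftEmbedding.2 hq
      exact f.injective.extend_apply _ _ _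
    · rw [Function.extend_apply' _ _ _ fun h => hq (mem_range_shiftEmbedding.1 h),
        hx q (not_le.1 hq)]
      rfl
  have hee' : ∀ j, e' (e (b j)) = b j := fun j =>
    Prod.ext (hext _ (hfst j)) (hext _ fun q _ => congrFun (hsnd j) q)
  obtain ⟨htn, C, -, hC⟩ := (hb.map e e' hee').exists_circuit_pauliZ
    fun j => by
      change (b j).2 ∘ f = 0
      rw [hsnd j]; rfl
  refine ⟨htn, Circuit.relabel f C, fun P hP => ?_, fun j q hq => ?_⟩
  · refine Circuit.act_relabel_of_restrict_eq_zero f C (Prod.ext ?_ ?_) <;> funext p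
    exacts [(hP _ (mem_range_shiftEmbedding.1 ⟨p, rfl⟩)).1,
      (hP _ (mem_range_shiftEmbedding.1 ⟨p, rfl⟩)).2]
  · have hqf : q = f ⟨j, by omega⟩ := Fin.ext hq
    refine Circuit.act_relabel_eq f C ((hC j ⟨j, by omega⟩ rfl).trans ?_) fun p hp => ?_
    · refine Prod.ext ?_ rfl
      funext p
      simp [pauliZ, PauliSeq.restrict, hqf, Pi.single_apply]
    · have hpr : p.val < r := not_le.1 fun h => hp (mem_range_shiftEmbedding.2 h)
      have hpq : p ≠ q := fun h => by rw [h] at hpr; omega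
      rw [hfst j p hpr, hsnd j]
      simp [pauliZ, hpq]

/-- Normal form of a pair of primitive families, of type `Z` and `X`, whose matrix of symplectic
products is `[1 0; 0 0]`: a circuit takes the pairs of members with product `1` to `Z` and `X` on
the first `c` qubits, and all other members to `Z` on different further qubits. -/
theorem exists_circuit_normalForm {n r s c : ℕ} (hcr : c ≤ r) (hcs : c ≤ s)
    {a : Fin r → PauliSeq (Fin n)} {b : Fin s → PauliSeq (Fin n)}
    (ha : IsPrimitiveFamily BinLaurent a) (hb : IsPrimitiveFamily BinLaurent b)
    (ha₂ : ∀ i, (a i).2 = 0) (hb₁ : ∀ j, (b j).1 = 0)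
    (hab : ∀ i j, shiftedSymplectic (a i) (b j) = if i.val = j.val ∧ i.val < c then 1 else 0) :
    r + (s - c) ≤ n ∧ ∃ C : Circuit (Fin n),
      (∀ (i : Fin r) (q : Fin n), q.val = i.val → Circuit.act C (a i) = pauliZ q) ∧
      (∀ (j : Fin s) (q : Fin n), j.val < c → q.val = j.val → Circuit.act C (b j) = pauliX q) ∧
      (∀ (j : Fin s) (q : Fin n), c ≤ j.val → q.val + c = r + j.val →
        Circuit.act C (b j) = pauliZ q) := by
  obtain ⟨hrn, C₁, hC₁, hC₁a⟩ := ha.exists_circuit_pauliZ ha₂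
  -- After the reduction of `a`, the products with `a` are the first `r` coordinates of `b`.
  let x : Fin s → Fin n → BinLaurent := fun j => (Circuit.act C₁ (b j)).2
  have hx : ∀ j, Circuit.act C₁ (b j) = (0, x j) := fun j =>
    Prod.ext (hC₁.act_fst_eq_zero (hb₁ j)) rfl
  have hxr : ∀ (j : Fin s) (q : Fin n), q.val < r →
      x j q = if q.val = j.val ∧ q.val < c then 1 else 0 := fun j q hq => by
    rw [← hab ⟨q, hq⟩ j, ← Circuit.shiftedSymplectic_act C₁, hC₁a ⟨q, hq⟩ q rfl,
      shiftedSymplectic_pauliZ_left]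
  let S : Finset (Fin n) := {q | q.val < r}
  have hS : ∀ q, q ∈ S ↔ q.val < r := fun q => by simp [S]
  -- Clear the coordinates of `b j`, `j < c`, from `r` on, by CNOTs controlled by the qubit `j`;
  -- these are transvections between two layers of Hadamard gates.
  let v : Fin n → Fin n → BinLaurent := fun j q =>
    if h : j.val < c ∧ r ≤ q.val then x ⟨j, h.1.trans_le hcs⟩ q else 0
  have hv : ∀ j, ∀ q ∈ S, v j q = 0 := fun j q hq =>
    dif_neg fun h => absurd ((hS q).1 hq) (not_lt.2 h.2)
  obtain ⟨C₂, hC₂⟩ := exists_circuit_transvections S v fun j _ => hv j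
  obtain ⟨W, hW⟩ := exists_circuit_hadamard (Finset.univ : Finset (Fin n))
  obtain ⟨W', hW'⟩ := exists_circuit_hadamard Sᶜ
  let C₃ := W ++ (C₂ ++ W)
  have hC₃ : ∀ P, Circuit.act C₃ P = (P.1 + ∑ j ∈ S, Pi.single j (∑ q, invert (v j q) * P.1 q),
      P.2 + ∑ j ∈ S, P.2 j • v j) := fun P => by
    simp only [C₃, Circuit.act_append, hW, hC₂, Finset.piecewise_univ]
  have hC₃a : ∀ q ∈ S, Circuit.act C₃ (pauliZ q) = pauliZ q := fun q hq => by
    have h0 : ∀ j, ∑ p, invert (v j p) * (pauliZ q : PauliSeq (Fin n)).1 p = 0 := fun j => by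
      refine Finset.sum_eq_zero fun p _ => ?_
      by_cases hp : p = q
      · rw [hp, hv j q hq, map_zero, zero_mul]
      · simp [pauliZ, hp]
    rw [hC₃]
    simp only [h0]
    simp [pauliZ]
  have hC₃b : ∀ (j : Fin s) (q : Fin n), j.val < c → q.val = j.val →
      Circuit.act C₃ (0, x j) = pauliX q := fun j q hj hq => by
    rw [hC₃]
    refine Prod.ext (by simp [pauliX]) ?_
    have hsum : ∑ i ∈ S, x j i • v i = v q := by
      rw [Finset.sum_eq_single q]
      · rw [hxr j q (by omega), if_pos ⟨hq, by omega⟩, one_smul]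
      · intro i hi hiq
        rw [hxr j i ((hS i).1 hi), if_neg fun h => hiq (Fin.ext (h.1.trans hq.symm)), zero_smul]
      · exact fun h => absurd ((hS q).2 (by omega)) h
    dsimp only
    rw [hsum]
    funext p
    rw [Pi.add_apply]
    by_cases hp : p.val < r
    · rw [hv q p ((hS p).2 hp), hxr j p hp, add_zero]
      simp only [pauliX, Pi.single_apply]
      exact if_congr (by rw [Fin.ext_iff]; omega) rfl rfl
    · have hpq : p ≠ q := fun h => by rw [h] at hp; omega
      have hjq : (⟨q, by omega⟩ : Fin s) = j := Fin.ext hq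
      have hvp : v q p = x j p := by
        simp only [v]
        rw [dif_pos ⟨by omega, by omega⟩, hjq]
      rw [hvp, binLaurent_add_self]
      simp [pauliX, hpq]
  have hC₃b' : ∀ j : Fin s, c ≤ j.val → Circuit.act C₃ (0, x j) = (0, x j) := fun j hj => by
    rw [hC₃]
    refine Prod.ext (by simp) ?_
    have hsum : ∑ i ∈ S, x j i • v i = 0 := Finset.sum_eq_zero fun i hi => by
      rw [hxr j i ((hS i).1 hi), if_neg (by omega), zero_smul]
    dsimp only
    rw [hsum, add_zero]
  have hW'Z : ∀ q ∈ S, Circuit.act W' (pauliZ q) = pauliZ q := fun q hq => by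
    rw [hW']
    refine Prod.ext ?_ ?_ <;> funext p <;> by_cases hp : p ∈ S
    · simp [Finset.piecewise, hp]
    · have hpq : p ≠ q := fun h => hp (h ▸ hq)
      simp [Finset.piecewise, hp, pauliZ, hpq]
    · simp [Finset.piecewise, hp]
    · have hpq : p ≠ q := fun h => hp (h ▸ hq)
      simp [Finset.piecewise, hp, pauliZ, hpq]
  have hW'X : ∀ q ∈ S, Circuit.act W' (pauliX q) = pauliX q := fun q hq => by
    rw [hW']
    refine Prod.ext ?_ ?_ <;> funext p <;> by_cases hp : p ∈ S
    · simp [Finset.piecewise, hp]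
    · have hpq : p ≠ q := fun h => hp (h ▸ hq)
      simp [Finset.piecewise, hp, pauliX, hpq]
    · simp [Finset.piecewise, hp]
    · have hpq : p ≠ q := fun h => hp (h ▸ hq)
      simp [Finset.piecewise, hp, pauliX, hpq]
  have hW'b : ∀ j : Fin s, c ≤ j.val → Circuit.act W' (0, x j) = (x j, 0) := fun j hj => by
    rw [hW']
    refine Prod.ext ?_ ?_ <;> funext p <;> by_cases hp : p ∈ S
    · have : x j p = 0 := by rw [hxr j p ((hS p).1 hp), if_neg (by omega)]
      simp [Finset.piecewise, hp, this]
    · simp [Finset.piecewise, hp]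
    · have : x j p = 0 := by rw [hxr j p ((hS p).1 hp), if_neg (by omega)]
      simp [Finset.piecewise, hp, this]
    · simp [Finset.piecewise, hp]
  -- What is left of `b` is reduced on the remaining qubits.
  have hact : ∀ j : Fin s, c ≤ j.val →
      Circuit.act (C₁ ++ (C₃ ++ W')) (b j) = (x j, 0) := fun j hj => by
    rw [Circuit.act_append, Circuit.act_append, hx, hC₃b' j hj, hW'b j hj]
  have hb' := (hb.act (C₁ ++ (C₃ ++ W'))).comp_injective
    (f := fun j : Fin (s - c) => (⟨c + j, by omega⟩ : Fin s))
    fun i j h => by simpa [Fin.ext_iff] using h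
  obtain ⟨htn, C₄, hC₄, hC₄b⟩ := hb'.exists_circuit_pauliZ_shift (r := r)
    (fun j => by rw [hact _ (Nat.le_add_right _ _)])
    (fun j q hq => by
      rw [hact _ (Nat.le_add_right _ _)]
      dsimp only
      rw [hxr _ q hq, if_neg (by dsimp only; omega)])
  refine ⟨by omega, (C₁ ++ (C₃ ++ W')) ++ C₄, fun i q hq => ?_, fun j q hj hq => ?_,
    fun j q hj hq => ?_⟩
  · have hqS : q ∈ S := (hS q).2 (by omega)
    rw [Circuit.act_append, Circuit.act_append, Circuit.act_append, hC₁a i q hq, hC₃a q hqS,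
      hW'Z q hqS]
    refine hC₄ _ fun p hp => ?_
    have hpq : p ≠ q := fun h => by rw [h] at hp; omega
    simp [pauliZ, hpq]
  · have hqS : q ∈ S := (hS q).2 (by omega)
    rw [Circuit.act_append, Circuit.act_append, Circuit.act_append, hx, hC₃b j q hj hq, hW'X q hqS]
    refine hC₄ _ fun p hp => ?_
    have hpq : p ≠ q := fun h => by rw [h] at hp; omega
    simp [pauliX, hpq]
  · have hjc : (⟨c + (j.val - c), by omega⟩ : Fin s) = j := Fin.ext (Nat.add_sub_cancel' hj)
    have := hC₄b ⟨j.val - c, by omega⟩ q (by dsimp only; omega)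
    dsimp only at this
    rwa [hjc, ← Circuit.act_append] at this

/-! ### The rows of the check matrix -/

/-- The powers of `D` in a monomial Smith form can be absorbed into the invertible factors. -/
theorem HasMonomialSmithForm.exists_isUnit {r s c : ℕ} {M : Matrix (Fin r) (Fin s) BinLaurent}
    (hM : HasMonomialSmithForm M c) :
    ∃ (E : Matrix (Fin r) (Fin r) BinLaurent) (F : Matrix (Fin s) (Fin s) BinLaurent),
      IsUnit E ∧ IsUnit F ∧
        ∀ i j, (E * M * F) i j = if i.val = j.val ∧ i.val < c then 1 else 0 := by
  obtain ⟨-, -, A, B, γ, ⟨⟨A, A', -, hA⟩, rfl⟩, ⟨⟨B, B', hB, hB'⟩, rfl⟩, rfl⟩ := hM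
  let δ : Fin r → BinLaurent := fun i => if h : i.val < c then T (-γ ⟨i, h⟩) else 1
  have hδ : IsUnit (Matrix.diagonal δ) := by
    rw [Matrix.isUnit_diagonal, Pi.isUnit_iff]
    intro i
    simp only [δ]
    split_ifs
    exacts [isUnit_T _, isUnit_one]
  have hA' : IsUnit A' := by
    rw [Matrix.isUnit_iff_isUnit_det]
    refine IsUnit.of_mul_eq_one A.det ?_
    rw [← Matrix.det_mul, hA, Matrix.det_one]
  refine ⟨Matrix.diagonal δ * A', B', hδ.mul hA', ⟨⟨B', B, hB', hB⟩, rfl⟩, fun i j => ?_⟩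
  have : Matrix.diagonal δ * A' * (A * monomialBlock r s γ * B) * B' =
      Matrix.diagonal δ * monomialBlock r s γ := by
    calc _ = Matrix.diagonal δ * (A' * A) * monomialBlock r s γ * (B * B') := by
          simp only [Matrix.mul_assoc]
      _ = _ := by rw [hA, hB, Matrix.mul_one, Matrix.mul_one]
  dsimp only
  rw [this, Matrix.diagonal_mul, monomialBlock, Matrix.of_apply]
  by_cases h : i.val = j.val ∧ i.val < c
  · rw [dif_pos h, if_pos h]
    simp only [δ, dif_pos h.2, T_neg_mul_T]
  · rw [dif_neg h, if_neg h, mul_zero]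

/-- The rows of a polynomial matrix as `Z` type Pauli sequences. -/
def zRows {r n : ℕ} (H : Matrix (Fin r) (Fin n) (ZMod 2)[X]) (i : Fin r) : PauliSeq (Fin n) :=
  (fun j => toLaurent (H i j), 0)

/-- The rows of a polynomial matrix as `X` type Pauli sequences. -/
def xRows {r n : ℕ} (H : Matrix (Fin r) (Fin n) (ZMod 2)[X]) (i : Fin r) : PauliSeq (Fin n) :=
  (0, fun j => toLaurent (H i j))

theorem IsNoncatastrophic.isPrimitiveFamily_zRows {r n : ℕ}
    {H : Matrix (Fin r) (Fin n) (ZMod 2)[X]} (hH : IsNoncatastrophic H) :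
    IsPrimitiveFamily BinLaurent (zRows H) :=
  hH.isPrimitiveFamily.map (LinearMap.inl BinLaurent (Fin n → BinLaurent) (Fin n → BinLaurent))
    (LinearMap.fst BinLaurent (Fin n → BinLaurent) (Fin n → BinLaurent)) fun _ => rfl

theorem IsNoncatastrophic.isPrimitiveFamily_xRows {r n : ℕ}
    {H : Matrix (Fin r) (Fin n) (ZMod 2)[X]} (hH : IsNoncatastrophic H) :
    IsPrimitiveFamily BinLaurent (xRows H) :=
  hH.isPrimitiveFamily.map (LinearMap.inr BinLaurent (Fin n → BinLaurent) (Fin n → BinLaurent))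
    (LinearMap.snd BinLaurent (Fin n → BinLaurent) (Fin n → BinLaurent)) fun _ => rfl

theorem shiftedSymplectic_zRows_xRows {r s n : ℕ} (H₁ : Matrix (Fin r) (Fin n) (ZMod 2)[X])
    (H₂ : Matrix (Fin s) (Fin n) (ZMod 2)[X]) (i : Fin r) (j : Fin s) :
    shiftedSymplectic (zRows H₁ i) (xRows H₂ j) = invert (crossMatrix H₁ H₂ i j) := by
  simp only [crossMatrix, Matrix.mul_apply, Matrix.transpose_apply, Matrix.map_apply, map_sum,
    map_mul]
  refine Finset.sum_congr rfl fun q _ => ?_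
  rw [involutive_invert]
  simp [zRows, xRows]

/-- The ring automorphism `D ↦ D⁻¹`, applied to the entries of a matrix. -/
def invertMatrix {s : ℕ} (F : Matrix (Fin s) (Fin s) BinLaurent) :
    Matrix (Fin s) (Fin s) BinLaurent :=
  (invert (R := ZMod 2)).toRingEquiv.toRingHom.mapMatrix F

/-- Row operations turn the matrix of symplectic products of the rows of `H₁` and `H₂` into
`E * crossMatrix H₁ H₂ * F`, up to `D ↦ D⁻¹`. -/
theorem shiftedSymplectic_rowCombination {r s n : ℕ} (H₁ : Matrix (Fin r) (Fin n) (ZMod 2)[X])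
    (H₂ : Matrix (Fin s) (Fin n) (ZMod 2)[X]) (E : Matrix (Fin r) (Fin r) BinLaurent)
    (F : Matrix (Fin s) (Fin s) BinLaurent) (i : Fin r) (j : Fin s) :
    shiftedSymplectic (rowCombination E (zRows H₁) i)
      (rowCombination (invertMatrix F.transpose) (xRows H₂) j) =
        invert ((E * crossMatrix H₁ H₂ * F) i j) := by
  have hF : ∀ k, invertMatrix F.transpose j k = invert (F k j) := fun _ => rfl
  simp only [rowCombination, shiftedSymplectic_sum_smul_left, shiftedSymplectic_sum_smul_right,
    shiftedSymplectic_zRows_xRows, hF, Matrix.mul_apply, map_sum, map_mul, Finset.mul_sum,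
    Finset.sum_mul]
  exact Finset.sum_congr rfl fun _ _ => Finset.sum_congr rfl fun _ _ => by ring

theorem cssCheckModule_eq_span {r s n : ℕ} (H₁ : Matrix (Fin r) (Fin n) (ZMod 2)[X])
    (H₂ : Matrix (Fin s) (Fin n) (ZMod 2)[X]) {E : Matrix (Fin r) (Fin r) BinLaurent}
    {F : Matrix (Fin s) (Fin s) BinLaurent} (hE : IsUnit E) (hF : IsUnit F) :
    cssCheckModule H₁ H₂ = Submodule.span BinLaurent
      (Set.range (rowCombination E (zRows H₁)) ∪ Set.range (rowCombination F (xRows H₂))) := by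
  obtain ⟨E', hE'⟩ := hE.exists_left_inv
  obtain ⟨F', hF'⟩ := hF.exists_left_inv
  rw [Submodule.span_union, span_range_rowCombination hE', span_range_rowCombination hF',
    ← Submodule.span_union]
  rfl

/-! ### Stabilizers -/

theorem senderPart_senderAct {c n : ℕ} (C : Circuit (Fin n)) (P : PauliSeq (Fin c ⊕ Fin n)) :
    senderPart c n (senderAct c C P) = Circuit.act C (senderPart c n P) :=
  Circuit.restrict_act_relabel Function.Embedding.inr C P

theorem senderAct_senderAct_inv {c n : ℕ} (C : Circuit (Fin n)) (P : PauliSeq (Fin c ⊕ Fin n)) :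
    senderAct c C (senderAct c (Circuit.inv C) P) = P := by
  have := Circuit.act_act_inv (Circuit.relabel (Function.Embedding.inr : Fin n ↪ Fin c ⊕ Fin n) C) P
  rwa [Circuit.inv_relabel] at this

theorem senderPart_pauliZ_inl {c n : ℕ} (i : Fin c) : senderPart c n (pauliZ (Sum.inl i)) = 0 := by
  refine Prod.ext ?_ rfl
  funext p
  simp [senderPart, pauliZ, LinearMap.funLeft_apply]

theorem senderPart_pauliX_inl {c n : ℕ} (i : Fin c) : senderPart c n (pauliX (Sum.inl i)) = 0 := by
  refine Prod.ext rfl ?_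
  funext p
  simp [senderPart, pauliX, LinearMap.funLeft_apply]

theorem senderPart_pauliZ_inr {c n : ℕ} (q : Fin n) :
    senderPart c n (pauliZ (Sum.inr q)) = pauliZ q := by
  refine Prod.ext ?_ rfl
  funext p
  simp [senderPart, pauliZ, LinearMap.funLeft_apply, Pi.single_apply]

theorem senderPart_pauliX_inr {c n : ℕ} (q : Fin n) :
    senderPart c n (pauliX (Sum.inr q)) = pauliX q := by
  refine Prod.ext rfl ?_
  funext p
  simp [senderPart, pauliX, LinearMap.funLeft_apply, Pi.single_apply]

theorem shiftedSymplectic_eq_zero_of_mem_span {ι : Type} [Fintype ι] {s : Set (PauliSeq ι)}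
    (hs : ∀ P ∈ s, ∀ Q ∈ s, shiftedSymplectic P Q = 0) {P Q : PauliSeq ι}
    (hP : P ∈ Submodule.span BinLaurent s) (hQ : Q ∈ Submodule.span BinLaurent s) :
    shiftedSymplectic P Q = 0 := by
  induction hP using Submodule.span_induction with
  | zero => exact shiftedSymplectic_zero_left Q
  | add P P' _ _ h h' => rw [shiftedSymplectic_add_left, h, h', add_zero]
  | smul a P _ h => rw [shiftedSymplectic_smul_left, h, mul_zero]
  | mem P hP =>
    induction hQ using Submodule.span_induction with
    | zero => exact shiftedSymplectic_zero_right P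
    | add Q Q' _ _ h h' => rw [shiftedSymplectic_add_right, h, h', add_zero]
    | smul a Q _ h => rw [shiftedSymplectic_smul_right, h, mul_zero]
    | mem Q hQ => exact hs P hP Q hQ

theorem shiftedSymplectic_pauliZ_pauliZ {ι : Type} [Fintype ι] [DecidableEq ι] (p q : ι) :
    shiftedSymplectic (pauliZ p) (pauliZ q) = 0 :=
  shiftedSymplectic_pauliZ_left p _

theorem shiftedSymplectic_pauliX_pauliX {ι : Type} [Fintype ι] [DecidableEq ι] (p q : ι) :
    shiftedSymplectic (pauliX p) (pauliX q) = 0 :=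
  shiftedSymplectic_pauliX_left p _

theorem shiftedSymplectic_pauliZ_pauliX {ι : Type} [Fintype ι] [DecidableEq ι] (p q : ι) :
    shiftedSymplectic (pauliZ p) (pauliX q) = if p = q then 1 else 0 :=
  (shiftedSymplectic_pauliZ_left p _).trans (Pi.single_apply (M := BinLaurent) q 1 p)

theorem shiftedSymplectic_pauliX_pauliZ {ι : Type} [Fintype ι] [DecidableEq ι] (p q : ι) :
    shiftedSymplectic (pauliX p) (pauliZ q) = if p = q then 1 else 0 :=
  (shiftedSymplectic_pauliX_left p _).trans (Pi.single_apply (M := BinLaurent) q 1 p)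

theorem shiftedSymplectic_unencodedStabilizer {n c m : ℕ} {P Q : PauliSeq (Fin c ⊕ Fin n)}
    (hP : P ∈ unencodedStabilizer n c m) (hQ : Q ∈ unencodedStabilizer n c m) :
    shiftedSymplectic P Q = 0 := by
  refine shiftedSymplectic_eq_zero_of_mem_span ?_ hP hQ
  -- The two halves of an ebit contribute equally.
  have hite : ∀ {i j : Fin c} {p q : Fin n}, p.val = i.val → q.val = j.val →
      ((if i = j then 1 else 0) + (if p = q then 1 else 0) : BinLaurent) = 0 := by
    intro i j p q hp hq
    have : i = j ↔ p = q := by rw [Fin.ext_iff, Fin.ext_iff]; omega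
    simp only [this, binLaurent_add_self]
  have hne : ∀ {i : Fin c} {p q : Fin n}, p.val = i.val → c ≤ q.val → p ≠ q := by
    rintro i p q hp hq rfl
    omega
  rintro P (⟨i, p, hp, hP | hP⟩ | ⟨p, hp, -, hP⟩) Q (⟨j, q, hq, hQ | hQ⟩ | ⟨q, hq, -, hQ⟩) <;>
    rw [hP, hQ] <;>
    simp only [shiftedSymplectic_add_left, shiftedSymplectic_add_right,
      shiftedSymplectic_pauliZ_pauliZ, shiftedSymplectic_pauliX_pauliX,
      shiftedSymplectic_pauliZ_pauliX, shiftedSymplectic_pauliX_pauliZ, Sum.inl.injEq,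
      Sum.inr.injEq, reduceCtorEq, if_false, add_zero, zero_add]
  · exact hite hp hq
  · exact hite hp hq
  · exact if_neg (hne hp hq)
  · exact if_neg (hne hq hp).symm

theorem shiftedSymplectic_encodedStabilizer {n c m : ℕ} {C : Circuit (Fin n)}
    {P Q : PauliSeq (Fin c ⊕ Fin n)} (hP : P ∈ encodedStabilizer c m C)
    (hQ : Q ∈ encodedStabilizer c m C) : shiftedSymplectic P Q = 0 := by
  obtain ⟨P, hP, rfl⟩ := hP
  obtain ⟨Q, hQ, rfl⟩ := hQ
  exact (Circuit.shiftedSymplectic_act _ P Q).trans (shiftedSymplectic_unencodedStabilizer hP hQ)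

/-- A circuit that brings two families to the normal form takes the module they generate to the
sender's part of the unencoded stabilizer. -/
theorem map_senderPart_unencodedStabilizer {n r s c m : ℕ} (hcr : c ≤ r) (hcs : c ≤ s)
    (hm : r + (s - c) + m = n) {a : Fin r → PauliSeq (Fin n)} {b : Fin s → PauliSeq (Fin n)}
    {C : Circuit (Fin n)}
    (ha : ∀ (i : Fin r) (q : Fin n), q.val = i.val → Circuit.act C (a i) = pauliZ q)
    (hbX : ∀ (j : Fin s) (q : Fin n), j.val < c → q.val = j.val → Circuit.act C (b j) = pauliX q)
    (hbZ : ∀ (j : Fin s) (q : Fin n), c ≤ j.val → q.val + c = r + j.val →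
      Circuit.act C (b j) = pauliZ q) :
    (unencodedStabilizer n c m).map (senderPart c n) =
      (Submodule.span BinLaurent (Set.range a ∪ Set.range b)).map (Circuit.act C) := by
  have hmema : ∀ i, Circuit.act C (a i) ∈
      (Submodule.span BinLaurent (Set.range a ∪ Set.range b)).map (Circuit.act C) := fun i =>
    Submodule.mem_map_of_mem (Submodule.subset_span (Or.inl ⟨i, rfl⟩))
  have hmemb : ∀ j, Circuit.act C (b j) ∈
      (Submodule.span BinLaurent (Set.range a ∪ Set.range b)).map (Circuit.act C) := fun j =>
    Submodule.mem_map_of_mem (Submodule.subset_span (Or.inr ⟨j, rfl⟩))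
  refine le_antisymm ?_ ?_
  · rw [unencodedStabilizer, Submodule.map_span, Submodule.span_le]
    rintro _ ⟨P, ⟨i, q, hq, rfl | rfl⟩ | ⟨q, hcq, hqm, rfl⟩, rfl⟩
    · rw [map_add, senderPart_pauliZ_inl, senderPart_pauliZ_inr, zero_add,
        ← ha ⟨i, i.isLt.trans_le hcr⟩ q hq]
      exact hmema _
    · rw [map_add, senderPart_pauliX_inl, senderPart_pauliX_inr, zero_add,
        ← hbX ⟨i, i.isLt.trans_le hcs⟩ q i.isLt hq]
      exact hmemb _
    · rw [senderPart_pauliZ_inr]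
      by_cases hqr : q.val < r
      · rw [← ha ⟨q, hqr⟩ q rfl]
        exact hmema _
      · rw [← hbZ ⟨q + c - r, by omega⟩ q (by dsimp only; omega) (by dsimp only; omega)]
        exact hmemb _
  · have hanc : ∀ q : Fin n, c ≤ q.val → q.val + m < n →
        pauliZ q ∈ (unencodedStabilizer n c m).map (senderPart c n) := fun q hcq hqm =>
      ⟨_, Submodule.subset_span (Or.inr ⟨q, hcq, hqm, rfl⟩), senderPart_pauliZ_inr q⟩
    rw [Submodule.map_span, Submodule.span_le]
    rintro _ ⟨_, ⟨i, rfl⟩ | ⟨j, rfl⟩, rfl⟩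
    · have hq : i.val < n := by omega
      rw [ha i ⟨i, hq⟩ rfl]
      by_cases hic : i.val < c
      · refine ⟨_, Submodule.subset_span (Or.inl ⟨⟨i, hic⟩, ⟨i, hq⟩, rfl, Or.inl rfl⟩), ?_⟩
        rw [map_add, senderPart_pauliZ_inl, senderPart_pauliZ_inr, zero_add]
      · exact hanc _ (not_lt.1 hic) (by dsimp only; omega)
    · by_cases hjc : j.val < c
      · have hq : j.val < n := by omega
        rw [hbX j ⟨j, hq⟩ hjc rfl]
        refine ⟨_, Submodule.subset_span (Or.inl ⟨⟨j, hjc⟩, ⟨j, hq⟩, rfl, Or.inr rfl⟩), ?_⟩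
        rw [map_add, senderPart_pauliX_inl, senderPart_pauliX_inr, zero_add]
      · rw [hbZ j ⟨r + j - c, by omega⟩ (not_lt.1 hjc) (by dsimp only; omega)]
        exact hanc _ (by dsimp only; omega) (by dsimp only; omega)

theorem isDecodingCircuit_inv {n : ℕ} (c m : ℕ) (C : Circuit (Fin n)) :
    IsDecodingCircuit c m (Circuit.inv C) C := by
  refine ⟨?_, fun q _ => ⟨senderAct_senderAct_inv C _, senderAct_senderAct_inv C _⟩⟩
  have : (senderAct c C).comp (senderAct c (Circuit.inv C)) = LinearMap.id :=
    LinearMap.ext fun P => senderAct_senderAct_inv C P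
  rw [encodedStabilizer, ← Submodule.map_comp, this, Submodule.map_id]

theorem map_senderPart_encodedStabilizer_inv {n c m : ℕ} {C : Circuit (Fin n)}
    {N : Submodule BinLaurent (PauliSeq (Fin n))}
    (h : (unencodedStabilizer n c m).map (senderPart c n) = N.map (Circuit.act C)) :
    (encodedStabilizer c m (Circuit.inv C)).map (senderPart c n) = N := by
  have hcomm : (senderPart c n).comp (senderAct c (Circuit.inv C)) =
      (Circuit.act (Circuit.inv C)).comp (senderPart c n) :=
    LinearMap.ext fun P => senderPart_senderAct _ P
  have hid : (Circuit.act (Circuit.inv C)).comp (Circuit.act C) = LinearMap.id :=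
    LinearMap.ext fun P => Circuit.act_inv_act C P
  rw [encodedStabilizer, ← Submodule.map_comp, hcomm, Submodule.map_comp, h, ← Submodule.map_comp,
    hid, Submodule.map_id]

end EAQCC

end

theorem mainTheorem2 (n k₁ k₂ c : ℕ) (hk₁ : k₁ ≤ n) (hk₂ : k₂ ≤ n)
    (H₁ : Matrix (Fin (n - k₁)) (Fin n) (Polynomial (ZMod 2)))
    (H₂ : Matrix (Fin (n - k₂)) (Fin n) (Polynomial (ZMod 2)))
    (hnc₁ : EAQCC.IsNoncatastrophic H₁) (hdf₁ : EAQCC.IsDelayFree H₁)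
    (hnc₂ : EAQCC.IsNoncatastrophic H₂) (hdf₂ : EAQCC.IsDelayFree H₂)
    (hSmith : EAQCC.HasMonomialSmithForm (EAQCC.crossMatrix H₁ H₂) c) :
    ∃ m : ℕ, m + n = k₁ + k₂ + c ∧
      ∃ enc dec : EAQCC.Circuit (Fin n),
        EAQCC.IsEncodingCircuit H₁ H₂ c m enc ∧ EAQCC.IsDecodingCircuit c m enc dec := by
  open EAQCC in
  have hcr := hSmith.1
  have hcs := hSmith.2.1
  obtain ⟨E, F, hE, hF, hEF⟩ := hSmith.exists_isUnit
  have hF' : IsUnit (invertMatrix F.transpose) :=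
    ((Matrix.isUnit_transpose F).2 hF).map
      (LaurentPolynomial.invert (R := ZMod 2)).toRingEquiv.toRingHom.mapMatrix
  obtain ⟨E', hE'⟩ := hE.exists_right_inv
  obtain ⟨G, hG⟩ := hF'.exists_right_inv
  obtain ⟨hn, C, ha, hbX, hbZ⟩ := exists_circuit_normalForm hcr hcs
    (hnc₁.isPrimitiveFamily_zRows.rowCombination hE')
    (hnc₂.isPrimitiveFamily_xRows.rowCombination hG)
    (fun i => by simp [rowCombination, zRows, Prod.snd_sum])
    (fun j => by simp [rowCombination, xRows, Prod.fst_sum])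
    (fun i j => by
      rw [shiftedSymplectic_rowCombination, hEF]
      split_ifs <;> simp)
  refine ⟨n - (n - k₁ + (n - k₂ - c)), by omega, Circuit.inv C, C,
    ⟨by omega, fun P hP Q hQ => shiftedSymplectic_encodedStabilizer hP hQ, ?_⟩,
    isDecodingCircuit_inv c _ C⟩
  rw [cssCheckModule_eq_span H₁ H₂ hE hF']
  exact map_senderPart_encodedStabilizer_inv
    (map_senderPart_unencodedStabilizer hcr hcs (by omega) ha hbX hbZ)
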